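/- **Market.** Let $\Omega$ (objects) and $N$ (buyers) be finite sets, with supplies $b_i\in\mathbb Z_{\ge 0}$, demands $d_j\in\mathbb Z_{\ge 0}$ and values $v_{ij}\in\mathbb Z_{\ge 0}$ for $i\in\Omega$, $j\in N$. Price vectors are $p\in\mathbb R_{\ge 0}^{\Omega}$. The set $D_j(p)$ of preferred bundles of buyer $j$ consists of the maximizers of $\sum_i (v_{ij}-p(i))y_i$ over $y\in\mathbb Z_{\ge0}^\Omega$ with $\sum_i y_i\le d_j$ and $y_i\le b_i$ for all $i$. An allocation $x\in\mathbb Z_{\ge 0}^{\Omega\times N}$ is feasible if $\sum_j x_{ij}\le b_i$ for all $i$ and $\sum_i x_{ij}\le d_j$ for all $j$; it is stable at $p$ if moreover $x_{\bullet j}\in D_j(p)$ for all $j$. Prices $p$ are competitive if a stable allocation exists, and Walrasian if a stable allocation exists that sells $\min\{\sum_i b_i,\sum_j d_j\}$ items in total. Buyer-optimal Walrasian prices are Walrasian prices with minimum $\sum_i p(i)$ among all Walrasian prices. **Tiers.** Order the objects by non-increasing payoff $v_{ij}-p(i)$. The greedy algorithm for buyer $j$ runs through this order and takes $\min\{b_i,\text{residual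 demand}\}$ items of the current object $i$, as long as the residual demand (initially $d_j$) and the payoff of $i$ are positive. Let $k_j$ be the object selected last; let $\Omega_j'$ and $\Omega_j''$ be the sets of objects whose payoff is larger than, respectively equal to, the payoff of $k_j$ (both empty if nothing is selected), and let $\Omega_j'''$ be the set of objects of payoff zero. Put $d_{j'}=\sum_{i\in\Omega_j'}b_i$, $d_{j''}=\min\{\sum_{i\in\Omega_j''}b_i,\,d_j-d_{j'}\}$ and $d_{j'''}=\min\{\sum_{i\in\Omega_j'''}b_i,\,d_j-d_{j'}-d_{j''}\}$. **Networks.** $G(p)$ has a source $s$, a sink $t$, a vertex for each object, and vertices $j',j''$ for each buyer $j$. Its arcs are $(s,j')$ of capacity $d_{j'}$, $(s,j'')$ of capacity $d_{j''}$, $(j',i)$ of capacity $b_i$ for $i\in\Omega_j'$, $(j'',i)$ of capacity $\min\{b_i,d_{j''}\}$ for $i\in\Omega_j''$, and $(i,t)$ of capacity $b_i$. To build $H(p)$, first balance the market: if $\sum_i b_i<\sum_j d_j$, add a dummy object with the missing supply, price $0$, and value $0$ for all buyers; if $\sum_i b_i>\sum_j d_j$, add a dummy buyer with the missing demand and all values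 $0$. Then take $G(p)$ for the balanced market and add, for each buyer $j$, a vertex $j'''$, the arc $(s,j''')$ of capacity $d_{j'''}$, and the arcs $(j''',i)$ of capacity $b_i$ for $i\in\Omega_j'''$. **Price-Raising Algorithm.** Start with $p=0$. While the maximum flow value in $G(p)$ is less than the total capacity of the arcs leaving $s$, raise by $1$ the prices of all objects in the left-most (inclusion-wise minimal) minimum $s$-$t$ cut of $G(p)$. Return the final prices. **Allocation Algorithm.** Given $p$, find an integral maximum flow $f$ in $H(p)$ and return $x_{ij}=f_{j'i}+f_{j''i}+f_{j'''i}$ for $i\in\Omega$, $j\in N$. **Theorem.** The Price-Raising Algorithm terminates, and its output $p^*$ is uniquely determined. It is the component-wise minimum competitive price vector: $p^*$ is competitive, and $p^*(i)\le q(i)$ for all $i\in\Omega$ and all competitive $q$. The Allocation Algorithm has an output at $p^*$, and every allocation $x^*$ that it can return at $p^*$ is stable at $p^*$, sells $\min\{\sum_i b_i,\sum_j d_j\}$ items in total, and satisfies $\sum_j x^*_{ij}=b_i$ for every $i$ with $p^*(i)>0$. Consequently $p^*$ is the unique buyer-optimal Walrasian price vector. -/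

import Mathlib

/-- A finite network: nonnegative integral capacities on ordered pairs of vertices (capacity `0`
means that there is no arc), a source and a sink. -/
structure FlowNetwork (V : Type*) where
  cap : V → V → ℕ
  source : V
  sink : V

namespace FlowNetwork

variable {V : Type*} [Fintype V]

/-- Integral `s`-`t`-flows: capacity constraints and flow conservation at all inner vertices. -/
def IsFlow (G : FlowNetwork V) (f : V → V → ℕ) : Prop :=
  (∀ u w, f u w ≤ G.cap u w) ∧
    ∀ w, w ≠ G.source → w ≠ G.sink → ∑ u, f u w = ∑ u, f w u

/-- The value of a flow: net amount leaving the source. -/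
def value (G : FlowNetwork V) (f : V → V → ℕ) : ℤ :=
  (∑ w, (f G.source w : ℤ)) - ∑ w, (f w G.source : ℤ)

/-- Integral flows of maximum value. -/
def IsMaxFlow (G : FlowNetwork V) (f : V → V → ℕ) : Prop :=
  G.IsFlow f ∧ ∀ g, G.IsFlow g → G.value g ≤ G.value f

/-- The total capacity of the arcs leaving the source. -/
def sourceCapacity (G : FlowNetwork V) : ℕ := ∑ w, G.cap G.source w

open scoped Classical in
/-- The total capacity of the arcs leaving the vertex set `S`. -/
noncomputable def cutCapacity (G : FlowNetwork V) (S : Finset V) : ℕ :=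
  ∑ u ∈ S, ∑ w ∈ Sᶜ, G.cap u w

/-- `S` is an `s`-`t`-cut. -/
def IsCut (G : FlowNetwork V) (S : Finset V) : Prop := G.source ∈ S ∧ G.sink ∉ S

/-- `S` is an `s`-`t`-cut of minimum capacity. -/
def IsMinCut (G : FlowNetwork V) (S : Finset V) : Prop :=
  G.IsCut S ∧ ∀ S', G.IsCut S' → G.cutCapacity S ≤ G.cutCapacity S'

/-- Left-most min cuts: inclusion-wise minimal minimum cuts. -/
def IsLeftmostMinCut (G : FlowNetwork V) (S : Finset V) : Prop := Minimal G.IsMinCut S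

end FlowNetwork

/-- A market with object types `Ω` and buyers `N`: supplies `b i`, demands `d j`, and the value
`v i j` of one unit of object `i` for buyer `j`. -/
structure Market (Ω N : Type*) where
  supply : Ω → ℕ
  demand : N → ℕ
  value : Ω → N → ℕ

namespace Market

variable {Ω N : Type*} [Fintype Ω] [Fintype N]

/-! ### Competitive and Walrasian prices -/

/-- The utility (payoff) of one unit of object `i` for buyer `j` at prices `p`. -/
def payoff (M : Market Ω N) (p : Ω → ℝ) (j : N) (i : Ω) : ℝ := (M.value i j : ℝ) - p i

/-- The bundles that buyer `j` may choose from. -/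
def bundles (M : Market Ω N) (j : N) : Set (Ω → ℕ) :=
  {y | ∑ i, y i ≤ M.demand j ∧ ∀ i, y i ≤ M.supply i}

/-- The preferred bundles of buyer `j` at prices `p`. -/
def preferredBundles (M : Market Ω N) (p : Ω → ℝ) (j : N) : Set (Ω → ℕ) :=
  {y | y ∈ M.bundles j ∧ IsMaxOn (fun z : Ω → ℕ => ∑ i, M.payoff p j i * (z i : ℝ)) (M.bundles j) y}

/-- Feasible allocations; `x i j` is the number of items of object `i` given to buyer `j`. -/
def IsFeasible (M : Market Ω N) (x : Ω → N → ℕ) : Prop :=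
  (∀ i, ∑ j, x i j ≤ M.supply i) ∧ ∀ j, ∑ i, x i j ≤ M.demand j

/-- Stable allocations: feasible, and every buyer gets a preferred bundle. -/
def IsStable (M : Market Ω N) (p : Ω → ℝ) (x : Ω → N → ℕ) : Prop :=
  M.IsFeasible x ∧ ∀ j, (fun i => x i j) ∈ M.preferredBundles p j

/-- As much as possible is sold. -/
def SellsMaximum (M : Market Ω N) (x : Ω → N → ℕ) : Prop :=
  ∑ i, ∑ j, x i j = min (∑ i, M.supply i) (∑ j, M.demand j)

/-- Competitive price vectors: nonnegative prices that admit a stable allocation. -/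
def IsCompetitive (M : Market Ω N) (p : Ω → ℝ) : Prop :=
  (∀ i, 0 ≤ p i) ∧ ∃ x, M.IsStable p x

/-- Walrasian price vectors: nonnegative prices that admit a stable allocation under which as much
as possible is sold. -/
def IsWalrasian (M : Market Ω N) (p : Ω → ℝ) : Prop :=
  (∀ i, 0 ≤ p i) ∧ ∃ x, M.IsStable p x ∧ M.SellsMaximum x

/-- Buyer-optimal Walrasian price vectors: those with minimum sum of prices. -/
def IsBuyerOptimal (M : Market Ω N) (p : Ω → ℝ) : Prop :=
  M.IsWalrasian p ∧ ∀ q, M.IsWalrasian q → ∑ i, p i ≤ ∑ i, q i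

/-! ### The greedy algorithm for a minimal preferred bundle, and the three tiers of a buyer -/

/-- An ordering of all objects by non-increasing payoff of buyer `j`. -/
def IsGreedyOrder (M : Market Ω N) (p : Ω → ℝ) (j : N) (l : List Ω) : Prop :=
  l.Nodup ∧ (∀ i, i ∈ l) ∧ l.Pairwise (fun i k => M.payoff p j k ≤ M.payoff p j i)

open scoped Classical in
/-- The object that the greedy algorithm selects last: it runs through the list, with residual
demand `r`, as long as the residual demand and the payoff of the current object are positive, and
takes as many items of the current object as it can. The result is `none` if the algorithm stops
before it has selected any object. -/
noncomputable def lastSelected (M : Market Ω N) (p : Ω → ℝ) (j : N) : List Ω → ℕ → Option Ω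
  | [], _ => none
  | i :: l, r =>
      if 0 < r ∧ p i < (M.value i j : ℝ) then
        some ((M.lastSelected p j l (r - min (M.supply i) r)).getD i)
      else none

/-- `k` is the object selected last by the greedy algorithm for buyer `j`, for some ordering by
payoffs. (The payoff of `k` does not depend on the ordering.) -/
def IsLastSelected (M : Market Ω N) (p : Ω → ℝ) (j : N) (k : Ω) : Prop :=
  ∃ l, M.IsGreedyOrder p j l ∧ M.lastSelected p j l (M.demand j) = some k

open scoped Classical in
/-- The set `Ω_j'(p)` of objects with larger payoff than the object selected last. -/
noncomputable def tierOne (M : Market Ω N) (p : Ω → ℝ) (j : N) : Finset Ω :=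
  {i | ∃ k, M.IsLastSelected p j k ∧ M.payoff p j k < M.payoff p j i}

open scoped Classical in
/-- The set `Ω_j''(p)` of objects with the same payoff as the object selected last. -/
noncomputable def tierTwo (M : Market Ω N) (p : Ω → ℝ) (j : N) : Finset Ω :=
  {i | ∃ k, M.IsLastSelected p j k ∧ M.payoff p j i = M.payoff p j k}

open scoped Classical in
/-- The set `Ω_j'''(p)` of objects with payoff zero. -/
noncomputable def tierThree (M : Market Ω N) (p : Ω → ℝ) (j : N) : Finset Ω :=
  {i | M.payoff p j i = 0}

/-- The amount `d_{j'}(p)`. -/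
noncomputable def demandOne (M : Market Ω N) (p : Ω → ℝ) (j : N) : ℕ :=
  ∑ i ∈ M.tierOne p j, M.supply i

/-- The amount `d_{j''}(p)`. (The subtraction does not truncate, as `demandOne ≤ demand`.) -/
noncomputable def demandTwo (M : Market Ω N) (p : Ω → ℝ) (j : N) : ℕ :=
  min (∑ i ∈ M.tierTwo p j, M.supply i) (M.demand j - M.demandOne p j)

/-- The amount `d_{j'''}(p)`. -/
noncomputable def demandThree (M : Market Ω N) (p : Ω → ℝ) (j : N) : ℕ :=
  min (∑ i ∈ M.tierThree p j, M.supply i) (M.demand j - M.demandOne p j - M.demandTwo p j)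

/-! ### The auxiliary network `G(p)` and the price-raising algorithm -/

/-- The vertices of `G(p)`: source, sink, two vertices `j'`, `j''` for each buyer, and the
objects. -/
inductive VertexG (Ω N : Type*) where
  | s : VertexG Ω N
  | t : VertexG Ω N
  | buyer' (j : N) : VertexG Ω N
  | buyer'' (j : N) : VertexG Ω N
  | object (i : Ω) : VertexG Ω N
  deriving Fintype

open scoped Classical in
/-- The network `G(p)`. -/
noncomputable def networkG (M : Market Ω N) (p : Ω → ℝ) : FlowNetwork (VertexG Ω N) where
  cap
    | .s, .buyer' j => M.demandOne p j
    | .s, .buyer'' j => M.demandTwo p j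
    | .buyer' j, .object i => if i ∈ M.tierOne p j then M.supply i else 0
    | .buyer'' j, .object i =>
        if i ∈ M.tierTwo p j then min (M.supply i) (M.demandTwo p j) else 0
    | .object i, .t => M.supply i
    | _, _ => 0
  source := .s
  sink := .t

open scoped Classical in
/-- One iteration of the price-raising algorithm, from prices `p` to prices `q`: if a maximum flow
in `G(p)` does not saturate the arcs leaving the source, then the prices of all objects in the
left-most min cut are raised by one. -/
def PriceStep (M : Market Ω N) (p q : Ω → ℝ) : Prop :=
  (∃ f, (M.networkG p).IsMaxFlow f ∧
      (M.networkG p).value f < ((M.networkG p).sourceCapacity : ℤ)) ∧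
    ∃ C, (M.networkG p).IsLeftmostMinCut C ∧
      ∀ i, q i = p i + if VertexG.object i ∈ C then 1 else 0

/-- The stopping criterion of the price-raising algorithm at prices `p`. -/
def PriceStop (M : Market Ω N) (p : Ω → ℝ) : Prop :=
  ∃ f, (M.networkG p).IsMaxFlow f ∧
    (M.networkG p).value f = ((M.networkG p).sourceCapacity : ℤ)

/-- The price-raising algorithm, started at prices zero, returns the prices `p` (after finitely
many iterations). -/
def PriceRaisingReturns (M : Market Ω N) (p : Ω → ℝ) : Prop :=
  Relation.ReflTransGen M.PriceStep (fun _ => 0) p ∧ M.PriceStop p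

/-! ### The network `H(p)` and the allocation algorithm -/

/-- The balanced market: a dummy object (`none`) of value zero makes up for missing supply, and a
dummy buyer (`none`) with valuation zero for missing demand. By truncated subtraction at most one
of them has positive size; a dummy of size zero has no effect. -/
def balanced (M : Market Ω N) : Market (Option Ω) (Option N) where
  supply
    | some i => M.supply i
    | none => ∑ j, M.demand j - ∑ i, M.supply i
  demand
    | some j => M.demand j
    | none => ∑ i, M.supply i - ∑ j, M.demand j
  value
    | some i, some j => M.value i j
    | _, _ => 0

/-- Prices in the balanced market: the dummy object has price zero. -/
def extendPrice (p : Ω → ℝ) : Option Ω → ℝ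
  | some i => p i
  | none => 0

/-- The vertices of the extension of `G(p)` by a third vertex `j'''` for each buyer. -/
inductive VertexH (Ω N : Type*) where
  | s : VertexH Ω N
  | t : VertexH Ω N
  | buyer' (j : N) : VertexH Ω N
  | buyer'' (j : N) : VertexH Ω N
  | buyer''' (j : N) : VertexH Ω N
  | object (i : Ω) : VertexH Ω N
  deriving Fintype

open scoped Classical in
/-- The extension of `G(p)` by the vertices `j'''` and their arcs. -/
noncomputable def extendedNetwork (M : Market Ω N) (p : Ω → ℝ) : FlowNetwork (VertexH Ω N) where
  cap
    | .s, .buyer' j => M.demandOne p j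
    | .s, .buyer'' j => M.demandTwo p j
    | .s, .buyer''' j => M.demandThree p j
    | .buyer' j, .object i => if i ∈ M.tierOne p j then M.supply i else 0
    | .buyer'' j, .object i =>
        if i ∈ M.tierTwo p j then min (M.supply i) (M.demandTwo p j) else 0
    | .buyer''' j, .object i => if i ∈ M.tierThree p j then M.supply i else 0
    | .object i, .t => M.supply i
    | _, _ => 0
  source := .s
  sink := .t

/-- The network `H(p)`, built on the balanced market. -/
noncomputable def networkH (M : Market Ω N) (p : Ω → ℝ) :
    FlowNetwork (VertexH (Option Ω) (Option N)) :=
  M.balanced.extendedNetwork (extendPrice p)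

/-- The allocation to the original buyers and objects given by the flow `f` on the arcs from the
vertices of the buyers to those of the objects. -/
def inducedAllocation (f : VertexH (Option Ω) (Option N) → VertexH (Option Ω) (Option N) → ℕ) :
    Ω → N → ℕ :=
  fun i j => f (.buyer' (some j)) (.object (some i)) + f (.buyer'' (some j)) (.object (some i)) +
    f (.buyer''' (some j)) (.object (some i))

/-- The allocation algorithm at prices `p` may return `x`: it is given by an integral maximum flow
in `H(p)`. -/
def AllocationReturns (M : Market Ω N) (p : Ω → ℝ) (x : Ω → N → ℕ) : Prop :=
  ∃ f, (M.networkH p).IsMaxFlow f ∧ x = inducedAllocation f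

end Market

/-!
Everything rests on a dual description of the preferred bundles. A bundle `y` of a buyer is
preferred if and only if it has a threshold `c ≥ 0`: everything of payoff above `c` is taken,
nothing of payoff below `c`, and `c = 0` unless the demand is exhausted
(`mem_preferredBundles_iff`). The greedy algorithm determines such a threshold, so that the
preferred bundles are also those that contain tier one, contain `demandTwo` items of tier two,
and are otherwise confined to tier three (`mem_preferredBundles_iff_tiers`). Consequently a flow
in `G(p)` that saturates the arcs leaving the source is a stable allocation, and the algorithm
can only stop at competitive prices.

*The prices stay below every competitive `r`.* A threshold can be rounded up together with the
payoffs, so `⌊r⌋` is competitive as well and the comparison is one of integers. The capacity of a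
cut of `G(p)` with objects `S` is at least the supply of `S` plus the sum over the buyers of
`outsideDemand`, with equality for a suitable cut. Let `S` be the set of objects of the left-most
min cut, and let `A ⊆ S` consist of the objects with `p = ⌊r⌋`. By `outsideDemand_sdiff_le`, the
outside demand of a buyer increases, as `S` shrinks to `S \ A`, by at most the number of items in
`A` that the buyer gets in an allocation that is stable at `⌊r⌋`; summed over the buyers this is
at most the supply of `A`. So some cut with objects `S \ A` is minimum too, and by submodularity
it contains the left-most one: `A` is empty, and raising the prices of `S` by one does not exceed
`⌊r⌋` (`PriceStep.le_of_isCompetitive`). By the max-flow min-cut theorem every step raises some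
price, and as prices above all values are competitive, the algorithm terminates. Its output is
the least competitive price vector, hence unique.

*All items of positive price are sold.* At the least competitive prices take a stable allocation
that maximizes the number of items sold, with weight two for the objects of positive price. If an
object `i₀` of positive price is undersold, consider the objects and buyers that are connected to
`i₀` by exchanges along which all thresholds are kept. An object of price zero or a buyer with
residual demand among them would allow an improvement (`IsStable.exists_exchange`); otherwise the
prices of the connected objects can be lowered by one (`IsStable.isCompetitive_lower`), against
minimality. The same exchanges show that no item is left over while there is residual demand
(`exists_isStable_sold`). This allocation extends to the balanced market, where it sells
everything and meets all demands. It is thus a flow in `H(p)` whose value is the total demand,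
and every maximum flow, having this value, saturates the network and is a stable allocation of
the balanced market (`tierAllocation_of_isFlow`). Removing the dummies yields the claims on the
allocation algorithm, and in particular that the least competitive prices are Walrasian. All
Walrasian prices being competitive, these are the only buyer-optimal ones.
-/

namespace Market

variable {Ω N : Type*}

/-! ### The object that the greedy algorithm selects last -/

theorem lastSelected_eq_none {M : Market Ω N} {p : Ω → ℝ} {j : N} {l : List Ω} {r : ℕ}
    (hl : l.Pairwise (fun i k => M.payoff p j k ≤ M.payoff p j i))
    (h : M.lastSelected p j l r = none) : r = 0 ∨ ∀ i ∈ l, M.payoff p j i ≤ 0 := by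
  cases l with
  | nil => simp
  | cons i l =>
    rw [lastSelected] at h
    split_ifs at h with hc
    rcases Nat.eq_zero_or_pos r with hr | hr
    · exact Or.inl hr
    · have hi : M.payoff p j i ≤ 0 := by
        rw [payoff, sub_nonpos]
        exact not_lt.1 fun h' => hc ⟨hr, h'⟩
      refine Or.inr fun k hk => ?_
      rcases List.mem_cons.1 hk with rfl | hk
      · exact hi
      · exact (List.rel_of_pairwise_cons hl hk).trans hi

open scoped Classical in
/-- The payoff of the object selected last is the smallest positive payoff such that the objects of
larger payoff do not exhaust the demand. -/
theorem lastSelected_eq_some {M : Market Ω N} {p : Ω → ℝ} {j : N} {l : List Ω} {r : ℕ} {k : Ω}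
    (hl : l.Pairwise (fun i k => M.payoff p j k ≤ M.payoff p j i))
    (h : M.lastSelected p j l r = some k) :
    k ∈ l ∧ 0 < M.payoff p j k ∧
      (l.map fun i => if M.payoff p j k < M.payoff p j i then M.supply i else 0).sum < r ∧
      ∀ i ∈ l, 0 < M.payoff p j i → M.payoff p j i < M.payoff p j k →
        r ≤ (l.map fun i => if M.payoff p j k ≤ M.payoff p j i then M.supply i else 0).sum := by
  induction l generalizing r k with
  | nil => simp [lastSelected] at h
  | cons i l ih =>
    have htop : ∀ a ∈ l, M.payoff p j a ≤ M.payoff p j i := fun a ha =>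
      List.rel_of_pairwise_cons hl ha
    have hl' := (List.pairwise_cons.1 hl).2
    have hzero : ∀ a, M.payoff p j i ≤ M.payoff p j a →
        (l.map fun i => if M.payoff p j a < M.payoff p j i then M.supply i else 0).sum = 0 := by
      intro a ha
      refine List.sum_eq_zero fun x hx => ?_
      obtain ⟨b, hb, rfl⟩ := List.mem_map.1 hx
      exact if_neg (not_lt.2 ((htop b hb).trans ha))
    rw [lastSelected] at h
    split_ifs at h with hc
    obtain ⟨hr, hpi⟩ := hc
    have hpi' : 0 < M.payoff p j i := sub_pos.2 hpi
    cases hrec : M.lastSelected p j l (r - min (M.supply i) r) with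
    | none =>
      rw [hrec] at h
      obtain rfl : i = k := by simpa using h
      refine ⟨by simp, hpi', ?_, fun a ha ha0 hai => ?_⟩
      · rw [List.map_cons, List.sum_cons, hzero i le_rfl]
        simpa using hr
      · have hal : a ∈ l := (List.mem_cons.1 ha).resolve_left (by rintro rfl; exact lt_irrefl _ hai)
        rcases lastSelected_eq_none hl' hrec with h0 | h0
        · rw [List.map_cons, List.sum_cons, if_pos le_rfl]
          omega
        · exact absurd (h0 a hal) (not_le.2 ha0)
    | some k' =>
      rw [hrec] at h
      obtain rfl : k' = k := by simpa using h
      obtain ⟨hk, hk0, hsum, hnext⟩ := ih hl' hrec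
      refine ⟨List.mem_cons_of_mem _ hk, hk0, ?_, fun a ha ha0 hai => ?_⟩
      · rw [List.map_cons, List.sum_cons]
        split_ifs with hki
        · omega
        · rw [hzero k' (not_lt.1 hki)]
          omega
      · have hal : a ∈ l := (List.mem_cons.1 ha).resolve_left (by
          rintro rfl
          exact absurd (htop k' hk) (not_le.2 hai))
        rw [List.map_cons, List.sum_cons, if_pos (htop k' hk)]
        have := hnext a hal ha0 hai
        omega

variable [Fintype Ω]

/-! ### Preferred bundles and thresholds -/

/-- `c` is a threshold for the bundle `y` of buyer `j`: all items of payoff above `c` are taken,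
none of payoff below `c`, and `c = 0` unless the demand is exhausted. -/
def IsThreshold (M : Market Ω N) (p : Ω → ℝ) (j : N) (y : Ω → ℕ) (c : ℝ) : Prop :=
  0 ≤ c ∧ (∀ i, c < M.payoff p j i → y i = M.supply i) ∧ (∀ i, M.payoff p j i < c → y i = 0) ∧
    (∑ i, y i < M.demand j → c = 0)

/-- No feasible change `e` of a preferred bundle increases the utility. -/
theorem sum_payoff_mul_nonpos_of_mem_preferredBundles {M : Market Ω N} {p : Ω → ℝ} {j : N}
    {y : Ω → ℕ} (hy : y ∈ M.preferredBundles p j) (e : Ω → ℤ) (h0 : ∀ i, 0 ≤ (y i : ℤ) + e i)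
    (hb : ∀ i, (y i : ℤ) + e i ≤ M.supply i) (hd : ∑ i, (y i : ℤ) + ∑ i, e i ≤ M.demand j) :
    ∑ i, M.payoff p j i * (e i : ℝ) ≤ 0 := by
  have hz : ∀ i, ((((y i : ℤ) + e i).toNat : ℕ) : ℤ) = y i + e i :=
    fun i => Int.toNat_of_nonneg (h0 i)
  have hmem : (fun i => ((y i : ℤ) + e i).toNat) ∈ M.bundles j := by
    refine ⟨?_, fun i => ?_⟩
    · zify
      simp only [hz, Finset.sum_add_distrib]
      exact hd
    · have := hz i
      have := hb i
      simp only
      omega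
  have h := hy.2 hmem
  simp only [Set.mem_ofPred_eq] at h
  have hz' : ∀ i, ((((y i : ℤ) + e i).toNat : ℕ) : ℝ) = y i + e i := fun i => by
    have := hz i
    exact_mod_cast congrArg (Int.cast (R := ℝ)) this
  simp only [hz', mul_add, Finset.sum_add_distrib] at h
  linarith

theorem exists_isThreshold_of_mem_preferredBundles {M : Market Ω N} {p : Ω → ℝ} {j : N}
    {y : Ω → ℕ} (hy : y ∈ M.preferredBundles p j) : ∃ c, M.IsThreshold p j y c := by
  classical
  have key := sum_payoff_mul_nonpos_of_mem_preferredBundles hy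
  have hyb := hy.1.2
  have hyd : ∑ i, (y i : ℤ) ≤ M.demand j := by exact_mod_cast hy.1.1
  have hpos : ∀ i, y i ≠ 0 → 0 ≤ M.payoff p j i := by
    intro i hi
    have := key (fun l => if l = i then -1 else 0) (fun l => by
      by_cases h : l = i <;> simp [h]; omega) (fun l => by
      have := hyb l
      split_ifs <;> omega) (by simp; omega)
    simpa using this
  by_cases hlt : ∑ i, y i < M.demand j
  · refine ⟨0, le_rfl, fun i hi => ?_, fun i hi => ?_, fun _ => rfl⟩
    · by_contra hne
      have hlt' : ∑ i, (y i : ℤ) < M.demand j := by exact_mod_cast hlt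
      have := key (fun l => if l = i then 1 else 0) (fun l => by
        split_ifs <;> omega) (fun l => by
        have := hyb l
        split_ifs with h
        · subst h; omega
        · omega) (by simp; omega)
      simp at this
      linarith
    · by_contra hne
      exact absurd (hpos i hne) (not_le.2 hi)
  · by_cases hfull : ∃ k, y k < M.supply k ∧ 0 < M.payoff p j k
    · -- The threshold is the largest payoff of an object that is not exhausted.
      obtain ⟨k₀, hk₀, hk₀'⟩ := hfull
      obtain ⟨k, hk, hmax⟩ := Finset.exists_max_image
        (Finset.univ.filter fun k => y k < M.supply k) (M.payoff p j) ⟨k₀, by simp [hk₀]⟩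
      have hk' : y k < M.supply k := by simpa using hk
      refine ⟨M.payoff p j k, ?_, fun i hi => ?_, fun i hi => ?_, fun h => absurd h hlt⟩
      · exact hk₀'.le.trans (hmax k₀ (by simp [hk₀]))
      · by_contra hne
        have := hyb i
        exact absurd (hmax i (by simp; omega)) (not_le.2 hi)
      · by_contra hne
        have hik : i ≠ k := by rintro rfl; exact lt_irrefl _ hi
        have := key (fun l => (if l = k then 1 else 0) - if l = i then 1 else 0) (fun l => by
          by_cases h : l = i
          · subst h; simp [hik]; omega
          · by_cases h' : l = k <;> simp [h, h'] ; omega) (fun l => by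
          have := hyb l
          by_cases h : l = k
          · subst h; simp [hik.symm]; omega
          · simp [h]; split_ifs <;> omega) (by simpa using hyd)
        simp [mul_sub, Finset.sum_sub_distrib] at this
        linarith
    · push Not at hfull
      refine ⟨0, le_rfl, fun i hi => ?_, fun i hi => ?_, fun _ => rfl⟩
      · by_contra hne
        have := hyb i
        exact absurd (hfull i (by omega)) (not_le.2 hi)
      · by_contra hne
        exact absurd (hpos i hne) (not_le.2 hi)

/-- A bundle is preferred if and only if it has a threshold: this is linear programming duality for
the buyer's choice problem, the threshold being the dual price of the demand constraint. -/
theorem mem_preferredBundles_iff {M : Market Ω N} {p : Ω → ℝ} {j : N} {y : Ω → ℕ} :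
    y ∈ M.preferredBundles p j ↔ y ∈ M.bundles j ∧ ∃ c, M.IsThreshold p j y c := by
  refine ⟨fun h => ⟨h.1, exists_isThreshold_of_mem_preferredBundles h⟩, ?_⟩
  rintro ⟨hy, c, hc0, hc1, hc2, hc3⟩
  refine ⟨hy, fun z hz => ?_⟩
  simp only [Set.mem_ofPred_eq]
  have h1 : ∑ i, (M.payoff p j i - c) * ((z i : ℝ) - y i) ≤ 0 := by
    refine Finset.sum_nonpos fun i _ => ?_
    rcases lt_trichotomy c (M.payoff p j i) with h | h | h
    · have hzi : (z i : ℝ) ≤ y i := by rw [hc1 i h]; exact_mod_cast hz.2 i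
      exact mul_nonpos_of_nonneg_of_nonpos (by linarith) (by linarith)
    · simp [h]
    · rw [hc2 i h]
      exact mul_nonpos_of_nonpos_of_nonneg (by linarith) (by simp)
  have h2 : c * ((∑ i, (z i : ℝ)) - ∑ i, (y i : ℝ)) ≤ 0 := by
    by_cases h : ∑ i, y i < M.demand j
    · simp [hc3 h]
    · refine mul_nonpos_of_nonneg_of_nonpos hc0 (sub_nonpos.2 ?_)
      exact_mod_cast hz.1.trans (not_lt.1 h)
  have h3 : ∑ i, (M.payoff p j i - c) * ((z i : ℝ) - y i) =
      ∑ i, M.payoff p j i * (z i : ℝ) - ∑ i, M.payoff p j i * (y i : ℝ)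
        - c * ((∑ i, (z i : ℝ)) - ∑ i, (y i : ℝ)) := by
    simp only [← Finset.sum_sub_distrib, Finset.mul_sum]
    exact Finset.sum_congr rfl fun i _ => by ring
  linarith

/-- On an upper level set of positive payoffs, a preferred bundle takes as much as possible. -/
theorem IsThreshold.sum_eq_min {M : Market Ω N} {p : Ω → ℝ} {j : N} {y : Ω → ℕ} {c : ℝ}
    (hc : M.IsThreshold p j y c) (hy : y ∈ M.bundles j) {E : Finset Ω}
    (hpos : ∀ i ∈ E, 0 < M.payoff p j i)
    (hup : ∀ i ∈ E, ∀ k, M.payoff p j i ≤ M.payoff p j k → k ∈ E) :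
    ∑ i ∈ E, y i = min (∑ i ∈ E, M.supply i) (M.demand j) := by
  obtain ⟨_, hc1, hc2, hc3⟩ := hc
  have hEd : ∑ i ∈ E, y i ≤ M.demand j :=
    (Finset.sum_le_univ_sum_of_nonneg (fun _ => Nat.zero_le _)).trans hy.1
  have hEb : ∑ i ∈ E, y i ≤ ∑ i ∈ E, M.supply i := Finset.sum_le_sum fun i _ => hy.2 i
  by_cases h : ∀ i ∈ E, y i = M.supply i
  · rw [Finset.sum_congr rfl h] at hEd ⊢
    exact (min_eq_left hEd).symm
  · push Not at h
    obtain ⟨i, hi, hne⟩ := h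
    have hic : M.payoff p j i ≤ c := not_lt.1 fun h => hne (hc1 i h)
    have hd : ¬ ∑ i, y i < M.demand j := fun h => by
      have := hc3 h
      have := hpos i hi
      linarith
    have hE : ∑ i ∈ E, y i = ∑ i, y i := by
      refine Finset.sum_subset (Finset.subset_univ E) fun k _ hk => hc2 k (not_le.1 fun h => hk ?_)
      exact hup i hi k (hic.trans h)
    omega

/-! ### Payoff levels of the tiers -/

theorem exists_isGreedyOrder (M : Market Ω N) (p : Ω → ℝ) (j : N) : ∃ l, M.IsGreedyOrder p j l := by
  classical
  let r : Ω → Ω → Prop := fun i k => M.payoff p j k ≤ M.payoff p j i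
  have : Std.Total r := ⟨fun a b => le_total _ _⟩
  have : IsTrans Ω r := ⟨fun a b c h h' => le_trans h' h⟩
  refine ⟨(Finset.univ : Finset Ω).toList.insertionSort r, ?_, fun i => ?_, ?_⟩
  · exact (List.perm_insertionSort r _).nodup_iff.2 (Finset.nodup_toList _)
  · exact (List.perm_insertionSort r _).mem_iff.2 (by simp)
  · exact List.pairwise_insertionSort r _

theorem IsLastSelected.spec {M : Market Ω N} {p : Ω → ℝ} {j : N} {k : Ω}
    (h : M.IsLastSelected p j k) {E F : Finset Ω}
    (hE : ∀ i, i ∈ E ↔ M.payoff p j k < M.payoff p j i)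
    (hF : ∀ i, i ∈ F ↔ M.payoff p j k ≤ M.payoff p j i) :
    0 < M.payoff p j k ∧ ∑ i ∈ E, M.supply i < M.demand j ∧
      ∀ i, 0 < M.payoff p j i → M.payoff p j i < M.payoff p j k →
        M.demand j ≤ ∑ i ∈ F, M.supply i := by
  classical
  obtain ⟨l, ⟨hnd, hall, hl⟩, hk⟩ := h
  obtain ⟨_, h1, h2, h3⟩ := lastSelected_eq_some hl hk
  have hsum : ∀ g : Ω → ℕ, (l.map g).sum = ∑ i, g i := fun g => by
    rw [← List.sum_toFinset g hnd]
    congr 1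
    ext i
    simp [hall i]
  have hE' : E = ({i | M.payoff p j k < M.payoff p j i} : Finset Ω) := by ext i; simp [hE]
  have hF' : F = ({i | M.payoff p j k ≤ M.payoff p j i} : Finset Ω) := by ext i; simp [hF]
  rw [hsum, ← Finset.sum_filter] at h2
  simp only [hsum, ← Finset.sum_filter] at h3
  subst hE' hF'
  exact ⟨h1, by convert h2, fun i hi hik => by convert h3 i (hall i) hi hik⟩

theorem IsLastSelected.payoff_le {M : Market Ω N} {p : Ω → ℝ} {j : N} {k k' : Ω}
    (h : M.IsLastSelected p j k) (h' : M.IsLastSelected p j k') :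
    M.payoff p j k ≤ M.payoff p j k' := by
  classical
  by_contra! hlt
  have h1 := h.spec (E := {i | M.payoff p j k < M.payoff p j i})
    (F := {i | M.payoff p j k ≤ M.payoff p j i}) (by simp) (by simp)
  have h2 := h'.spec (E := {i | M.payoff p j k' < M.payoff p j i})
    (F := {i | M.payoff p j k' ≤ M.payoff p j i}) (by simp) (by simp)
  have h3 := h1.2.2 k' h2.1 hlt
  have h4 : ∑ i with M.payoff p j k ≤ M.payoff p j i, M.supply i ≤
      ∑ i with M.payoff p j k' < M.payoff p j i, M.supply i :=
    Finset.sum_le_sum_of_subset fun i hi => by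
      simp only [Finset.mem_filter, Finset.mem_univ, true_and] at hi ⊢
      exact hlt.trans_le hi
  exact absurd (h3.trans h4) (not_le.2 h2.2.1)

/-- The description of the first two tiers by payoffs: either nothing is selected, or `c` is the
payoff of the object selected last. -/
theorem tiers_cases (M : Market Ω N) (p : Ω → ℝ) (j : N) :
    (M.tierOne p j = ∅ ∧ M.tierTwo p j = ∅ ∧ (M.demand j = 0 ∨ ∀ i, M.payoff p j i ≤ 0)) ∨
    ∃ c, 0 < c ∧ (∀ i, i ∈ M.tierOne p j ↔ c < M.payoff p j i) ∧
      (∀ i, i ∈ M.tierTwo p j ↔ M.payoff p j i = c) ∧ M.demandOne p j < M.demand j ∧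
      ∀ i, 0 < M.payoff p j i → M.payoff p j i < c →
        M.demand j ≤ M.demandOne p j + ∑ i ∈ M.tierTwo p j, M.supply i := by
  classical
  by_cases h : ∃ k, M.IsLastSelected p j k
  · obtain ⟨k, hk⟩ := h
    have h1 : ∀ i, i ∈ M.tierOne p j ↔ M.payoff p j k < M.payoff p j i := by
      intro i
      simp only [tierOne, Finset.mem_filter, Finset.mem_univ, true_and]
      exact ⟨fun ⟨k', hk', h⟩ => (hk.payoff_le hk').trans_lt h, fun h => ⟨k, hk, h⟩⟩
    have h2 : ∀ i, i ∈ M.tierTwo p j ↔ M.payoff p j i = M.payoff p j k := by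
      intro i
      simp only [tierTwo, Finset.mem_filter, Finset.mem_univ, true_and]
      exact ⟨fun ⟨k', hk', h⟩ => h.trans (le_antisymm (hk'.payoff_le hk) (hk.payoff_le hk')),
        fun h => ⟨k, hk, h⟩⟩
    have hdis : Disjoint (M.tierOne p j) (M.tierTwo p j) :=
      Finset.disjoint_left.2 fun i hi hi' => by
        rw [h1] at hi
        rw [h2] at hi'
        exact hi.ne' hi'
    obtain ⟨h3, h4, h5⟩ := hk.spec h1 (F := M.tierOne p j ∪ M.tierTwo p j) (fun i => by
      rw [Finset.mem_union, h1, h2, le_iff_lt_or_eq, eq_comm (a := M.payoff p j i)])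
    rw [Finset.sum_union hdis] at h5
    exact Or.inr ⟨_, h3, h1, h2, h4, h5⟩
  · push Not at h
    refine Or.inl ⟨by ext i; simp [tierOne, h], by ext i; simp [tierTwo, h], ?_⟩
    obtain ⟨l, hl⟩ := M.exists_isGreedyOrder p j
    have hn : M.lastSelected p j l (M.demand j) = none := by
      cases hs : M.lastSelected p j l (M.demand j) with
      | none => rfl
      | some k => exact absurd ⟨l, hl, hs⟩ (h k)
    exact (lastSelected_eq_none hl.2.2 hn).imp_right fun h i => h i (hl.2.1 i)

theorem demandOne_add_demandTwo_le (M : Market Ω N) (p : Ω → ℝ) (j : N) :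
    M.demandOne p j + M.demandTwo p j ≤ M.demand j := by
  have h : M.demandOne p j ≤ M.demand j := by
    rcases M.tiers_cases p j with ⟨h1, -⟩ | ⟨c, -, -, -, h, -⟩
    · simp [demandOne, h1]
    · exact h.le
  have : M.demandTwo p j ≤ M.demand j - M.demandOne p j := min_le_right _ _
  omega

theorem disjoint_tierOne_tierTwo (M : Market Ω N) (p : Ω → ℝ) (j : N) :
    Disjoint (M.tierOne p j) (M.tierTwo p j) := by
  rcases M.tiers_cases p j with ⟨h1, -⟩ | ⟨c, -, h1, h2, -⟩
  · simp [h1]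
  · exact Finset.disjoint_left.2 fun i hi hi' => ((h1 i).1 hi).ne' ((h2 i).1 hi')

theorem payoff_pos_of_mem_tierOne {M : Market Ω N} {p : Ω → ℝ} {j : N} {i : Ω}
    (hi : i ∈ M.tierOne p j) : 0 < M.payoff p j i := by
  rcases M.tiers_cases p j with ⟨h1, -⟩ | ⟨c, hc, h1, -⟩
  · simp [h1] at hi
  · exact hc.trans ((h1 i).1 hi)

theorem payoff_pos_of_mem_tierTwo {M : Market Ω N} {p : Ω → ℝ} {j : N} {i : Ω}
    (hi : i ∈ M.tierTwo p j) : 0 < M.payoff p j i := by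
  rcases M.tiers_cases p j with ⟨-, h2, -⟩ | ⟨c, hc, -, h2, -⟩
  · simp [h2] at hi
  · exact hc.trans_eq ((h2 i).1 hi).symm

theorem mem_tierThree {M : Market Ω N} {p : Ω → ℝ} {j : N} {i : Ω} :
    i ∈ M.tierThree p j ↔ M.payoff p j i = 0 := by
  simp [tierThree]

theorem IsThreshold.tiers {M : Market Ω N} {p : Ω → ℝ} {j : N} {y : Ω → ℕ} {c : ℝ}
    (hc : M.IsThreshold p j y c) (hy : y ∈ M.bundles j) :
    (∀ i ∈ M.tierOne p j, y i = M.supply i) ∧ ∑ i ∈ M.tierTwo p j, y i = M.demandTwo p j ∧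
      ∀ i, i ∉ M.tierOne p j → i ∉ M.tierTwo p j → i ∉ M.tierThree p j → y i = 0 := by
  classical
  rcases M.tiers_cases p j with ⟨h1, h2, h3⟩ | ⟨a, ha, h1, h2, h3, h4⟩
  · simp only [demandTwo, h1, h2, mem_tierThree]
    refine ⟨by simp, by simp, fun i _ _ hi => ?_⟩
    rcases h3 with h3 | h3
    · have : y i ≤ ∑ i, y i := Finset.single_le_sum (fun _ _ => Nat.zero_le _) (Finset.mem_univ i)
      have := hy.1
      omega
    · exact hc.2.2.1 i ((lt_of_le_of_ne (h3 i) hi).trans_le hc.1)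
  · have hs1 : ∑ i ∈ M.tierOne p j, y i = M.demandOne p j := by
      rw [hc.sum_eq_min hy (fun i => payoff_pos_of_mem_tierOne) (fun i hi k hk => ?_)]
      · exact min_eq_left h3.le
      · rw [h1] at hi ⊢
        exact hi.trans_le hk
    have hs2 : ∑ i ∈ M.tierOne p j ∪ M.tierTwo p j, y i =
        min (∑ i ∈ M.tierOne p j ∪ M.tierTwo p j, M.supply i) (M.demand j) := by
      refine hc.sum_eq_min hy (fun i hi => ?_) (fun i hi k hk => ?_)
      · exact (Finset.mem_union.1 hi).elim payoff_pos_of_mem_tierOne payoff_pos_of_mem_tierTwo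
      · rw [Finset.mem_union, h1, h2] at hi ⊢
        rcases hi with hi | hi
        · exact Or.inl (hi.trans_le hk)
        · rw [hi] at hk
          exact hk.lt_or_eq.imp_right Eq.symm
    rw [Finset.sum_union (M.disjoint_tierOne_tierTwo p j),
      Finset.sum_union (M.disjoint_tierOne_tierTwo p j)] at hs2
    have hd1 : ∑ i ∈ M.tierOne p j, M.supply i = M.demandOne p j := rfl
    refine ⟨fun i hi => ?_, ?_, fun i hi1 hi2 hi3 => ?_⟩
    · exact (Finset.sum_eq_sum_iff_of_le fun i _ => hy.2 i).1 (hs1.trans hd1.symm) i hi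
    · rw [demandTwo]
      omega
    · rw [h1] at hi1
      rw [h2] at hi2
      rw [mem_tierThree] at hi3
      rcases lt_or_gt_of_ne hi3 with h0 | h0
      · exact hc.2.2.1 i (h0.trans_le hc.1)
      · have hd := h4 i h0 (lt_of_le_of_ne (not_lt.1 hi1) hi2)
        have hins : ∑ k ∈ insert i (M.tierOne p j ∪ M.tierTwo p j), y k ≤ M.demand j :=
          (Finset.sum_le_univ_sum_of_nonneg (fun _ => Nat.zero_le _)).trans hy.1
        rw [Finset.sum_insert (by simp [h1, h2, hi1, hi2]),
          Finset.sum_union (M.disjoint_tierOne_tierTwo p j)] at hins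
        omega

theorem exists_isThreshold_of_tiers {M : Market Ω N} {p : Ω → ℝ} {j : N} {y : Ω → ℕ}
    (hy : y ∈ M.bundles j) (hy1 : ∀ i ∈ M.tierOne p j, y i = M.supply i)
    (hy2 : ∑ i ∈ M.tierTwo p j, y i = M.demandTwo p j)
    (hy3 : ∀ i, i ∉ M.tierOne p j → i ∉ M.tierTwo p j → i ∉ M.tierThree p j → y i = 0) :
    ∃ c, M.IsThreshold p j y c := by
  classical
  have hneg : ∀ i, M.payoff p j i < 0 → y i = 0 := fun i hi =>
    hy3 i (fun h => hi.not_gt (payoff_pos_of_mem_tierOne h))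
      (fun h => hi.not_gt (payoff_pos_of_mem_tierTwo h)) (fun h => hi.ne (mem_tierThree.1 h))
  rcases M.tiers_cases p j with ⟨h1, h2, h3 | h3⟩ | ⟨a, ha, h1, h2, h3, h4⟩
  · -- Without demand, any upper bound of the payoffs is a threshold.
    have hle : ∀ i, M.payoff p j i ≤ ∑ i, |M.payoff p j i| := fun i =>
      (le_abs_self _).trans
        (Finset.single_le_sum (f := fun i => |M.payoff p j i|) (fun _ _ => abs_nonneg _)
          (Finset.mem_univ i))
    refine ⟨∑ i, |M.payoff p j i|, Finset.sum_nonneg fun _ _ => abs_nonneg _,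
      fun i hi => absurd (hle i) (not_le.2 hi), fun i _ => ?_, fun h => by omega⟩
    have : y i ≤ ∑ i, y i := Finset.single_le_sum (fun _ _ => Nat.zero_le _) (Finset.mem_univ i)
    have := hy.1
    omega
  · exact ⟨0, le_rfl, fun i hi => absurd (h3 i) (not_le.2 hi), hneg, fun _ => rfl⟩
  · have hd1 : ∑ i ∈ M.tierOne p j, y i = M.demandOne p j := Finset.sum_congr rfl hy1
    have htot := M.demandOne_add_demandTwo_le p j
    by_cases hfull : M.demandOne p j + M.demandTwo p j = M.demand j
    · have hins : ∀ s : Finset Ω, ∑ k ∈ s, y k ≤ M.demand j := fun s =>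
        (Finset.sum_le_univ_sum_of_nonneg (fun _ => Nat.zero_le _)).trans hy.1
      refine ⟨a, ha.le, fun i hi => hy1 i ((h1 i).2 hi), fun i hi => ?_, fun h => ?_⟩
      · have := hins (insert i (M.tierOne p j ∪ M.tierTwo p j))
        rw [Finset.sum_insert (by simp [h1, h2, hi.le, hi.ne]),
          Finset.sum_union (M.disjoint_tierOne_tierTwo p j)] at this
        omega
      · have : ∑ k ∈ M.tierOne p j ∪ M.tierTwo p j, y k ≤ ∑ k, y k :=
          Finset.sum_le_univ_sum_of_nonneg (fun _ => Nat.zero_le _)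
        rw [Finset.sum_union (M.disjoint_tierOne_tierTwo p j)] at this
        omega
    · have hd2 : M.demandTwo p j =
        min (∑ i ∈ M.tierTwo p j, M.supply i) (M.demand j - M.demandOne p j) := rfl
      have hb2 : ∑ i ∈ M.tierTwo p j, y i = ∑ i ∈ M.tierTwo p j, M.supply i := by omega
      have hy2' := (Finset.sum_eq_sum_iff_of_le fun i _ => hy.2 i).1 hb2
      refine ⟨0, le_rfl, fun i hi => ?_, hneg, fun _ => rfl⟩
      rcases lt_trichotomy a (M.payoff p j i) with h | h | h
      · exact hy1 i ((h1 i).2 h)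
      · exact hy2' i ((h2 i).2 h.symm)
      · have := h4 i hi h
        omega

/-- The preferred bundles in terms of the tiers. -/
theorem mem_preferredBundles_iff_tiers {M : Market Ω N} {p : Ω → ℝ} {j : N} {y : Ω → ℕ} :
    y ∈ M.preferredBundles p j ↔ y ∈ M.bundles j ∧ (∀ i ∈ M.tierOne p j, y i = M.supply i) ∧
      ∑ i ∈ M.tierTwo p j, y i = M.demandTwo p j ∧
      ∀ i, i ∉ M.tierOne p j → i ∉ M.tierTwo p j → i ∉ M.tierThree p j → y i = 0 := by
  rw [mem_preferredBundles_iff]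
  exact ⟨fun ⟨hy, _, hc⟩ => ⟨hy, hc.tiers hy⟩,
    fun ⟨hy, h1, h2, h3⟩ => ⟨hy, exists_isThreshold_of_tiers hy h1 h2 h3⟩⟩

end Market

/-! ### Residual reachability and minimum cuts -/

namespace FlowNetwork

variable {V : Type*}

/-- A path to another vertex can be chosen not to return to its first vertex. -/
theorem exists_step_avoiding {r : V → V → Prop} {u w : V} (h : Relation.ReflTransGen r u w)
    (hne : w ≠ u) :
    ∃ u', r u u' ∧ u' ≠ u ∧ Relation.ReflTransGen (fun a b => r a b ∧ a ≠ u ∧ b ≠ u) u' w := by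
  induction h with
  | refl => exact absurd rfl hne
  | @tail b c _ hbc ih =>
    by_cases hb : b = u
    · subst hb
      exact ⟨c, hbc, hne, .refl⟩
    · obtain ⟨u', h1, h2, h3⟩ := ih hb
      exact ⟨u', h1, h2, h3.tail ⟨hbc, hb, hne⟩⟩

variable [Fintype V]

/-- The net amount that arrives at the vertex `v`. -/
def excess (f : V → V → ℕ) (v : V) : ℤ := ∑ u, (f u v : ℤ) - ∑ u, (f v u : ℤ)

/-- The arcs of the residual graph of `f` for lower bounds `lo` and upper bounds `hi`. -/
def Residual (lo hi f : V → V → ℕ) (u w : V) : Prop := f u w < hi u w ∨ lo w u < f w u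

open scoped Classical in
theorem exists_push_arc {lo hi f : V → V → ℕ} (hlo : ∀ u w, lo u w ≤ f u w)
    (hhi : ∀ u w, f u w ≤ hi u w) {u w : V} (h : Residual lo hi f u w) :
    ∃ g : V → V → ℕ, (∀ u w, lo u w ≤ g u w) ∧ (∀ u w, g u w ≤ hi u w) ∧
      (∀ a b, a ≠ u → b ≠ u → g a b = f a b) ∧
      ∀ v, excess g v = excess f v + (if v = w then 1 else 0) - if v = u then 1 else 0 := by
  rcases h with h | h
  · refine ⟨fun a b => f a b + if a = u ∧ b = w then 1 else 0, fun a b => ?_, fun a b => ?_,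
      fun a b ha hb => by simp [ha], fun v => ?_⟩
    · exact (hlo a b).trans (Nat.le_add_right _ _)
    · dsimp only
      split_ifs with h'
      · obtain ⟨rfl, rfl⟩ := h'
        omega
      · exact hhi a b
    · simp only [excess, Nat.cast_add, Finset.sum_add_distrib]
      have h1 : ∑ x, (((if x = u ∧ v = w then 1 else 0 : ℕ)) : ℤ) = if v = w then 1 else 0 := by
        by_cases hv : v = w <;> simp [hv]
      have h2 : ∑ x, (((if v = u ∧ x = w then 1 else 0 : ℕ)) : ℤ) = if v = u then 1 else 0 := by
        by_cases hv : v = u <;> simp [hv]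
      rw [h1, h2]
      ring
  · have hsub : ∀ a b, (((f a b - if a = w ∧ b = u then 1 else 0 : ℕ)) : ℤ) =
        f a b - ((if a = w ∧ b = u then 1 else 0 : ℕ) : ℤ) := fun a b => by
      split_ifs with h'
      · obtain ⟨rfl, rfl⟩ := h'
        omega
      · simp
    refine ⟨fun a b => f a b - if a = w ∧ b = u then 1 else 0, fun a b => ?_, fun a b => ?_,
      fun a b ha hb => by simp [hb], fun v => ?_⟩
    · dsimp only
      split_ifs with h'
      · obtain ⟨rfl, rfl⟩ := h'
        omega
      · exact hlo a b
    · exact (Nat.sub_le _ _).trans (hhi a b)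
    · simp only [excess, hsub, Finset.sum_sub_distrib]
      have h1 : ∑ x, (((if x = w ∧ v = u then 1 else 0 : ℕ)) : ℤ) = if v = u then 1 else 0 := by
        by_cases hv : v = u <;> simp [hv]
      have h2 : ∑ x, (((if v = w ∧ x = u then 1 else 0 : ℕ)) : ℤ) = if v = w then 1 else 0 := by
        by_cases hv : v = w <;> simp [hv]
      rw [h1, h2]
      ring

open scoped Classical in
/-- The push along a path, by induction on the number of vertices that are not forbidden. After a
push along the first arc the rest of the path, which avoids the first vertex, is still residual.
-/
theorem exists_push_avoiding {lo hi : V → V → ℕ} (n : ℕ) :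
    ∀ (X : Finset V) (f : V → V → ℕ) (u w : V),
    Xᶜ.card = n → (∀ u w, lo u w ≤ f u w) → (∀ u w, f u w ≤ hi u w) → u ∉ X →
    Relation.ReflTransGen (fun a b => Residual lo hi f a b ∧ a ∉ X ∧ b ∉ X) u w →
    ∃ g : V → V → ℕ, (∀ u w, lo u w ≤ g u w) ∧ (∀ u w, g u w ≤ hi u w) ∧
      ∀ v, excess g v = excess f v + (if v = w then 1 else 0) - if v = u then 1 else 0 := by
  induction n with
  | zero =>
    intro X f u w hX _ _ hu
    exact absurd (Finset.mem_compl.2 hu) (by simp [Finset.card_eq_zero.1 hX])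
  | succ n ih =>
    intro X f u w hX hlo hhi hu h
    by_cases hw : w = u
    · subst hw
      exact ⟨f, hlo, hhi, fun v => by ring⟩
    obtain ⟨u', h1, h2, h3⟩ := exists_step_avoiding h hw
    obtain ⟨g, hg1, hg2, hg3, hg4⟩ := exists_push_arc hlo hhi h1.1
    have hcard : (insert u X)ᶜ.card = n := by
      rw [Finset.compl_insert, Finset.card_erase_of_mem (Finset.mem_compl.2 hu), hX]
      rfl
    obtain ⟨g', hg1', hg2', hg3'⟩ := ih (insert u X) g u' w hcard hg1 hg2
      (by simp [h2, h1.2.2]) (Relation.ReflTransGen.mono (fun a b ⟨⟨hab, ha, hb⟩, ha', hb'⟩ => by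
        refine ⟨?_, by simp [ha, ha'], by simp [hb, hb']⟩
        rw [Residual, hg3 a b ha' hb', hg3 b a hb' ha']
        exact hab) _ _ h3)
    exact ⟨g', hg1', hg2', fun v => by rw [hg3', hg4]; ring⟩

open scoped Classical in
/-- One unit can be pushed along any path of the residual graph. -/
theorem exists_push {lo hi f : V → V → ℕ} (hlo : ∀ u w, lo u w ≤ f u w)
    (hhi : ∀ u w, f u w ≤ hi u w) {u w : V} (h : Relation.ReflTransGen (Residual lo hi f) u w) :
    ∃ g : V → V → ℕ, (∀ u w, lo u w ≤ g u w) ∧ (∀ u w, g u w ≤ hi u w) ∧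
      ∀ v, excess g v = excess f v + (if v = w then 1 else 0) - if v = u then 1 else 0 :=
  exists_push_avoiding _ ∅ f u w rfl hlo hhi (by simp)
    (Relation.ReflTransGen.mono (fun a b hab => by simpa using hab) _ _ h)

theorem value_eq_neg_excess (G : FlowNetwork V) (f : V → V → ℕ) :
    G.value f = - excess f G.source := by
  rw [value, excess]
  ring

theorem isFlow_iff_excess {G : FlowNetwork V} {f : V → V → ℕ} :
    G.IsFlow f ↔ (∀ u w, f u w ≤ G.cap u w) ∧
      ∀ w, w ≠ G.source → w ≠ G.sink → excess f w = 0 := by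
  refine and_congr_right fun _ => forall_congr' fun w => imp_congr_right fun _ =>
    imp_congr_right fun _ => ?_
  rw [excess, sub_eq_zero]
  exact_mod_cast Iff.rfl

/-- A maximum flow has the value of some cut. -/
theorem IsMaxFlow.exists_cut {G : FlowNetwork V} {f : V → V → ℕ} (hf : G.IsMaxFlow f)
    (hst : G.source ≠ G.sink) : ∃ S, G.IsCut S ∧ (G.cutCapacity S : ℤ) = G.value f := by
  classical
  obtain ⟨hcap, hexc⟩ := isFlow_iff_excess.1 hf.1
  -- The cut consists of the vertices reachable from the source in the residual graph.
  let R : Finset V := {v | Relation.ReflTransGen (Residual (fun _ _ => 0) G.cap f) G.source v}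
  have hR : ∀ v, v ∈ R ↔ Relation.ReflTransGen (Residual (fun _ _ => 0) G.cap f) G.source v :=
    fun v => by simp [R]
  have hs : G.source ∈ R := (hR _).2 .refl
  have ht : G.sink ∉ R := by
    intro ht
    obtain ⟨g, _, hg, hge⟩ := exists_push (fun _ _ => Nat.zero_le _) hcap ((hR _).1 ht)
    have hgf : G.IsFlow g := isFlow_iff_excess.2 ⟨hg, fun w h1 h2 => by
      rw [hge, hexc w h1 h2]
      simp [h1, h2]⟩
    have := hf.2 g hgf
    rw [value_eq_neg_excess, value_eq_neg_excess, hge] at this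
    simp [hst] at this
  have hres : ∀ u ∈ R, ∀ w ∉ R, f u w = G.cap u w ∧ f w u = 0 := by
    intro u hu w hw
    have hn : ¬ Residual (fun _ _ => 0) G.cap f u w := fun h => hw ((hR w).2 (((hR u).1 hu).tail h))
    simp only [Residual, not_or, not_lt] at hn
    exact ⟨le_antisymm (hcap u w) hn.1, by omega⟩
  refine ⟨R, ⟨hs, ht⟩, ?_⟩
  have h1 : ∑ v ∈ R, excess f v = excess f G.source :=
    Finset.sum_eq_single_of_mem _ hs fun v hv hne => hexc v hne (by rintro rfl; exact ht hv)
  have h2 : ∑ v ∈ R, excess f v = - (G.cutCapacity R : ℤ) := by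
    have hin : ∑ v ∈ R, ∑ u, (f u v : ℤ) = ∑ v ∈ R, ∑ u ∈ R, (f u v : ℤ) := by
      refine Finset.sum_congr rfl fun v hv => (Finset.sum_subset (Finset.subset_univ R) ?_).symm
      intro u _ hu
      rw [(hres v hv u hu).2]
      rfl
    have hout : ∑ v ∈ R, ∑ u, (f v u : ℤ) =
        ∑ v ∈ R, ∑ u ∈ R, (f v u : ℤ) + (G.cutCapacity R : ℤ) := by
      rw [cutCapacity, Nat.cast_sum, ← Finset.sum_add_distrib]
      refine Finset.sum_congr rfl fun v hv => ?_
      rw [← Finset.sum_add_sum_compl R]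
      congr 1
      rw [Nat.cast_sum]
      exact Finset.sum_congr (by congr) fun u hu => by
        rw [(hres v hv u (Finset.mem_compl.1 hu)).1]
    simp only [excess, Finset.sum_sub_distrib]
    rw [hin, hout, Finset.sum_comm]
    ring
  rw [value_eq_neg_excess, ← h1, h2, neg_neg]

theorem exists_isMaxFlow (G : FlowNetwork V) : ∃ f, G.IsMaxFlow f := by
  have hfin : Set.Finite {f : V → V → ℕ | G.IsFlow f} :=
    (Set.Finite.pi' fun u => Set.Finite.pi' fun w => Set.finite_Iic (G.cap u w)).subset
      fun f hf u w => hf.1 u w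
  have hne : {f : V → V → ℕ | G.IsFlow f}.Nonempty :=
    ⟨fun _ _ => 0, fun _ _ => Nat.zero_le _, by simp⟩
  obtain ⟨f, hf, hmax⟩ := hfin.exists_maximalFor G.value _ hne
  exact ⟨f, hf, fun g hg => (le_total _ _).elim id fun h => hmax hg h⟩

theorem exists_isLeftmostMinCut (G : FlowNetwork V) (hst : G.source ≠ G.sink) :
    ∃ S, G.IsLeftmostMinCut S := by
  have hne : {S : Finset V | G.IsCut S}.Nonempty := ⟨{G.source}, by simp [IsCut, hst.symm]⟩
  obtain ⟨S, hS, hmin⟩ := (Set.toFinite _).exists_minimalFor G.cutCapacity _ hne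
  obtain ⟨T, _, hT⟩ := exists_minimal_le_of_wellFoundedLT G.IsMinCut S
    ⟨hS, fun S' hS' => (le_total _ _).elim id fun h => hmin hS' h⟩
  exact ⟨T, hT⟩

open scoped Classical in
theorem cutCapacity_eq_sum (G : FlowNetwork V) (S : Finset V) :
    G.cutCapacity S = ∑ u, ∑ w, if u ∈ S ∧ w ∉ S then G.cap u w else 0 := by
  simp only [cutCapacity, ite_and, Finset.sum_ite_mem, Finset.sum_ite_irrel,
    Finset.sum_const_zero, Finset.univ_inter]
  refine Finset.sum_congr rfl fun u _ => ?_
  rw [← Finset.sum_filter]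
  exact Finset.sum_congr (by ext; simp) fun _ _ => rfl

open scoped Classical in
theorem cutCapacity_inter_add_union_le (G : FlowNetwork V) (S T : Finset V) :
    G.cutCapacity (S ∩ T) + G.cutCapacity (S ∪ T) ≤ G.cutCapacity S + G.cutCapacity T := by
  simp only [cutCapacity_eq_sum, ← Finset.sum_add_distrib]
  refine Finset.sum_le_sum fun u _ => Finset.sum_le_sum fun w _ => ?_
  by_cases h1 : u ∈ S <;> by_cases h2 : u ∈ T <;> by_cases h3 : w ∈ S <;> by_cases h4 : w ∈ T <;>
    simp [h1, h2, h3, h4]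

/-- The left-most min cut is contained in every min cut. -/
theorem IsLeftmostMinCut.subset {G : FlowNetwork V} {C D : Finset V} (hC : G.IsLeftmostMinCut C)
    (hD : G.IsCut D) (hle : G.cutCapacity D ≤ G.cutCapacity C) : C ⊆ D := by
  classical
  have hun : G.IsCut (C ∪ D) :=
    ⟨Finset.mem_union_left _ hC.1.1.1, by simp [hC.1.1.2, hD.2]⟩
  have hint : G.IsCut (C ∩ D) :=
    ⟨Finset.mem_inter.2 ⟨hC.1.1.1, hD.1⟩, fun h => hC.1.1.2 (Finset.mem_inter.1 h).1⟩
  have hmin : G.IsMinCut (C ∩ D) := by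
    refine ⟨hint, fun S' hS' => ?_⟩
    have h1 := G.cutCapacity_inter_add_union_le C D
    have h2 := hC.1.2 _ hun
    have h3 := hC.1.2 S' hS'
    omega
  exact (hC.2 hmin Finset.inter_subset_left).trans Finset.inter_subset_right

end FlowNetwork

namespace Market

variable {Ω N : Type*} [Fintype Ω]

/-! ### Prices rounded down -/

/-- When prices are rounded down, a threshold is rounded up together with the payoffs. -/
theorem IsThreshold.floor {M : Market Ω N} {p : Ω → ℝ} {j : N} {y : Ω → ℕ} {c : ℝ}
    (h : M.IsThreshold p j y c) : M.IsThreshold (fun i => (⌊p i⌋ : ℝ)) j y (⌈c⌉ : ℤ) := by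
  obtain ⟨h0, h1, h2, h3⟩ := h
  have hpay : ∀ i, M.payoff (fun i => (⌊p i⌋ : ℝ)) j i = (⌈M.payoff p j i⌉ : ℤ) := fun i => by
    simp only [payoff]
    rw [sub_eq_add_neg, sub_eq_add_neg, Int.ceil_natCast_add, Int.ceil_neg]
    push_cast
    ring
  refine ⟨by exact_mod_cast Int.ceil_nonneg h0, fun i hi => h1 i ?_,
    fun i hi => h2 i ?_, fun h => by simp [h3 h]⟩
  · rw [hpay, Int.cast_lt] at hi
    exact lt_of_not_ge fun h => absurd (Int.ceil_le_ceil h) (not_le.2 hi)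
  · rw [hpay, Int.cast_lt] at hi
    exact lt_of_not_ge fun h => absurd (Int.ceil_le_ceil h) (not_le.2 hi)

theorem preferredBundles_subset_floor (M : Market Ω N) (p : Ω → ℝ) (j : N) :
    M.preferredBundles p j ⊆ M.preferredBundles (fun i => (⌊p i⌋ : ℝ)) j := by
  intro y hy
  rw [mem_preferredBundles_iff] at hy ⊢
  exact ⟨hy.1, _, hy.2.choose_spec.floor⟩

/-! ### The demand for the objects of a cut -/

theorem sum_le_add_of_subset_union {ι : Type*} [DecidableEq ι] (f : ι → ℕ) {s t u : Finset ι}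
    (h : s ⊆ t ∪ u) : ∑ i ∈ s, f i ≤ ∑ i ∈ t, f i + ∑ i ∈ u, f i := by
  have h1 := Finset.sum_le_sum_of_subset (f := f) h
  have h2 := Finset.sum_union_inter (s₁ := t) (s₂ := u) (f := f)
  omega

open scoped Classical in
/-- The largest number of items outside `S` in a preferred bundle of minimum size of buyer `j`.
It is also the least contribution of `j` to the capacity of a cut of `G(p)` whose objects are
those of `S`. -/
noncomputable def outsideDemand (M : Market Ω N) (p : Ω → ℝ) (j : N) (S : Finset Ω) : ℕ :=
  ∑ i ∈ M.tierOne p j \ S, M.supply i +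
    min (M.demandTwo p j) (∑ i ∈ M.tierTwo p j \ S, M.supply i)

open scoped Classical in
/-- If the prices rise from `p` to `q`, strictly on `S \ A` but not on `A`, then the outside demand
increases, as `S` shrinks to `S \ A`, by at most the number of items of `A` in a bundle that is
preferred at `q`: compared with `A`, no object has become more attractive, and those of `S \ A` have
become less attractive. -/
theorem outsideDemand_sdiff_le {M : Market Ω N} {p q : Ω → ℝ} {j : N} {y : Ω → ℕ}
    (hy : y ∈ M.preferredBundles q j) (hpq : ∀ i, p i ≤ q i) {S A : Finset Ω}
    (hA : ∀ i ∈ A, q i = p i) (hSA : ∀ i ∈ S, i ∉ A → p i < q i) :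
    M.outsideDemand p j (S \ A) ≤ M.outsideDemand p j S + ∑ i ∈ A, y i := by
  obtain ⟨hyb, a, ha⟩ := mem_preferredBundles_iff.1 hy
  rcases M.tiers_cases p j with ⟨h1, h2, -⟩ | ⟨c, hc, h1, h2, h3, -⟩
  · simp [outsideDemand, h1, h2]
  have hpay : ∀ i, M.payoff q j i ≤ M.payoff p j i := fun i => sub_le_sub_left (hpq i) _
  have hpayA : ∀ i ∈ A, M.payoff q j i = M.payoff p j i := fun i hi => by simp [payoff, hA i hi]
  have hd1 : ∑ i ∈ M.tierOne p j, M.supply i = M.demandOne p j := rfl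
  have htot := M.demandOne_add_demandTwo_le p j
  -- All items of payoff above `c` at prices `q` are taken.
  have hfull : ∀ i, c < M.payoff q j i → y i = M.supply i := by
    let E : Finset Ω := {i | c < M.payoff q j i}
    have hE : ∀ i, i ∈ E ↔ c < M.payoff q j i := fun i => by simp [E]
    have hs := ha.sum_eq_min hyb (E := E) (fun i hi => hc.trans ((hE i).1 hi))
      (fun i hi k hk => (hE k).2 (((hE i).1 hi).trans_le hk))
    have hle : ∑ i ∈ E, M.supply i ≤ M.demandOne p j :=
      Finset.sum_le_sum_of_subset fun i hi => (h1 i).2 (((hE i).1 hi).trans_le (hpay i))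
    rw [min_eq_left (hle.trans h3.le)] at hs
    exact fun i hi => (Finset.sum_eq_sum_iff_of_le fun i _ => hyb.2 i).1 hs i ((hE i).2 hi)
  have hT1A : ∑ i ∈ M.tierOne p j ∩ A, M.supply i ≤ ∑ i ∈ A, y i := by
    refine le_trans (Finset.sum_le_sum fun i hi => ?_)
      (Finset.sum_le_sum_of_subset (f := y) Finset.inter_subset_right)
    obtain ⟨hi1, hi2⟩ := Finset.mem_inter.1 hi
    rw [hfull i (by rw [hpayA i hi2]; exact (h1 i).1 hi1)]
  have hX1 : ∑ i ∈ M.tierOne p j \ (S \ A), M.supply i ≤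
      ∑ i ∈ M.tierOne p j \ S, M.supply i + ∑ i ∈ M.tierOne p j ∩ A, M.supply i :=
    sum_le_add_of_subset_union _ fun i hi => by
      simp only [Finset.mem_sdiff, Finset.mem_union, Finset.mem_inter] at hi ⊢
      tauto
  have hX2 : ∑ i ∈ M.tierTwo p j \ (S \ A), M.supply i ≤
      ∑ i ∈ M.tierTwo p j \ S, M.supply i + ∑ i ∈ M.tierTwo p j ∩ A, M.supply i :=
    sum_le_add_of_subset_union _ fun i hi => by
      simp only [Finset.mem_sdiff, Finset.mem_union, Finset.mem_inter] at hi ⊢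
      tauto
  let E : Finset Ω := {i | c ≤ M.payoff q j i}
  have hE : ∀ i, i ∈ E ↔ c ≤ M.payoff q j i := fun i => by simp [E]
  have hs := ha.sum_eq_min hyb (E := E) (fun i hi => hc.trans_le ((hE i).1 hi))
    (fun i hi k hk => (hE k).2 (((hE i).1 hi).trans hk))
  have hor : ∑ i ∈ M.tierOne p j ∩ A, M.supply i + ∑ i ∈ M.tierTwo p j ∩ A, M.supply i ≤
        ∑ i ∈ A, y i ∨
      ∑ i ∈ M.tierOne p j ∩ A, M.supply i + M.demandTwo p j ≤
        ∑ i ∈ M.tierTwo p j \ S, M.supply i + ∑ i ∈ A, y i := by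
    rcases le_total (∑ i ∈ E, M.supply i) (M.demand j) with hle | hle
    · left
      rw [min_eq_left hle] at hs
      have hyE := (Finset.sum_eq_sum_iff_of_le fun i _ => hyb.2 i).1 hs
      rw [← Finset.sum_union ((M.disjoint_tierOne_tierTwo p j).mono Finset.inter_subset_left
        Finset.inter_subset_left), ← Finset.union_inter_distrib_right]
      refine le_trans (Finset.sum_le_sum fun i hi => ?_)
        (Finset.sum_le_sum_of_subset (f := y) Finset.inter_subset_right)
      obtain ⟨hi1, hi2⟩ := Finset.mem_inter.1 hi
      refine (hyE i ?_).ge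
      rw [hE, hpayA i hi2]
      exact (Finset.mem_union.1 hi1).elim (fun h => ((h1 i).1 h).le) fun h => ((h2 i).1 h).ge
    · right
      rw [min_eq_right hle] at hs
      have h5 : ∑ i ∈ E, y i ≤ ∑ i ∈ E \ A, y i + ∑ i ∈ A, y i :=
        sum_le_add_of_subset_union _ fun i hi => by
          simp only [Finset.mem_sdiff, Finset.mem_union]
          tauto
      have h6 : ∑ i ∈ E \ A, y i ≤ ∑ i ∈ E \ A, M.supply i := Finset.sum_le_sum fun i _ => hyb.2 i
      have h7 : ∑ i ∈ E \ A, M.supply i ≤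
          ∑ i ∈ M.tierOne p j \ A, M.supply i + ∑ i ∈ M.tierTwo p j \ S, M.supply i :=
        sum_le_add_of_subset_union _ fun i hi => by
          simp only [Finset.mem_sdiff, Finset.mem_union, hE, h1, h2] at hi ⊢
          rcases (hi.1.trans (hpay i)).lt_or_eq with h | h
          · exact Or.inl ⟨h, hi.2⟩
          · refine Or.inr ⟨h.symm, fun hS => ?_⟩
            have := hSA i hS hi.2
            have : M.payoff q j i < M.payoff p j i := sub_lt_sub_left this _
            linarith [hi.1]
      have h8 := Finset.sum_inter_add_sum_sdiff (M.tierOne p j) A M.supply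
      omega
  simp only [outsideDemand]
  omega

/-! ### The network `G(p)` -/

theorem networkG_cap_to_s (M : Market Ω N) (p : Ω → ℝ) (v : VertexG Ω N) :
    (M.networkG p).cap v .s = 0 := by
  cases v <;> rfl

theorem networkG_cap_to_buyer' (M : Market Ω N) (p : Ω → ℝ) (j : N) {v : VertexG Ω N}
    (hv : v ≠ .s) : (M.networkG p).cap v (.buyer' j) = 0 := by
  cases v
  case s => exact absurd rfl hv
  all_goals rfl

theorem networkG_cap_to_buyer'' (M : Market Ω N) (p : Ω → ℝ) (j : N) {v : VertexG Ω N}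
    (hv : v ≠ .s) : (M.networkG p).cap v (.buyer'' j) = 0 := by
  cases v
  case s => exact absurd rfl hv
  all_goals rfl

theorem networkG_cap_from_buyer' (M : Market Ω N) (p : Ω → ℝ) (j : N) {v : VertexG Ω N}
    (hv : ∀ i, v ≠ .object i) : (M.networkG p).cap (.buyer' j) v = 0 := by
  cases v
  case object i => exact absurd rfl (hv i)
  all_goals rfl

theorem networkG_cap_from_buyer'' (M : Market Ω N) (p : Ω → ℝ) (j : N) {v : VertexG Ω N}
    (hv : ∀ i, v ≠ .object i) : (M.networkG p).cap (.buyer'' j) v = 0 := by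
  cases v
  case object i => exact absurd rfl (hv i)
  all_goals rfl

theorem networkG_cap_from_object (M : Market Ω N) (p : Ω → ℝ) (i : Ω) {v : VertexG Ω N}
    (hv : v ≠ .t) : (M.networkG p).cap (.object i) v = 0 := by
  cases v
  case t => exact absurd rfl hv
  all_goals rfl

variable [Fintype N]

theorem sum_vertexG {A : Type*} [AddCommMonoid A] (F : VertexG Ω N → A) :
    ∑ v, F v = F .s + (F .t + (∑ j, F (.buyer' j) + (∑ j, F (.buyer'' j) + ∑ i, F (.object i)))) := by
  let e : Option (Option (N ⊕ N ⊕ Ω)) ≃ VertexG Ω N :=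
    { toFun := fun
        | none => .s
        | some none => .t
        | some (some (.inl j)) => .buyer' j
        | some (some (.inr (.inl j))) => .buyer'' j
        | some (some (.inr (.inr i))) => .object i
      invFun := fun
        | .s => none
        | .t => some none
        | .buyer' j => some (some (.inl j))
        | .buyer'' j => some (some (.inr (.inl j)))
        | .object i => some (some (.inr (.inr i)))
      left_inv := by rintro (_ | _ | _ | _ | _) <;> rfl
      right_inv := by rintro (_ | _ | _ | _ | _) <;> rfl }
  rw [← e.sum_comp]
  simp only [Fintype.sum_option, Fintype.sum_sum_type]
  rfl

theorem networkG_sourceCapacity (M : Market Ω N) (p : Ω → ℝ) :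
    (M.networkG p).sourceCapacity = ∑ j, M.demandOne p j + ∑ j, M.demandTwo p j := by
  rw [FlowNetwork.sourceCapacity, sum_vertexG]
  simp [networkG]

open scoped Classical in
theorem networkG_cutCapacity (M : Market Ω N) (p : Ω → ℝ) {C : Finset (VertexG Ω N)}
    (hC : (M.networkG p).IsCut C) :
    (M.networkG p).cutCapacity C =
      ∑ j, (if VertexG.buyer' j ∈ C then
          ∑ i ∈ M.tierOne p j, if VertexG.object i ∈ C then 0 else M.supply i
        else M.demandOne p j) +
      ∑ j, (if VertexG.buyer'' j ∈ C then
          ∑ i ∈ M.tierTwo p j, if VertexG.object i ∈ C then 0 else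
            min (M.supply i) (M.demandTwo p j)
        else M.demandTwo p j) +
      ∑ i, if VertexG.object i ∈ C then M.supply i else 0 := by
  have hs : VertexG.s ∈ C := hC.1
  have ht : VertexG.t ∉ C := hC.2
  have hsum : ∀ (T : Finset Ω) (f : Ω → ℕ), ∑ i ∈ T, f i = ∑ i, if i ∈ T then f i else 0 :=
    fun T f => by rw [Finset.sum_ite_mem, Finset.univ_inter]
  have h0 : ∑ w, (if VertexG.s ∈ C ∧ w ∉ C then (M.networkG p).cap .s w else 0) =
      ∑ j, (if VertexG.buyer' j ∈ C then 0 else M.demandOne p j) +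
        ∑ j, if VertexG.buyer'' j ∈ C then 0 else M.demandTwo p j := by
    have e1 : (M.networkG p).cap .s .t = 0 := rfl
    have e2 : ∀ j, (M.networkG p).cap .s (.buyer' j) = M.demandOne p j := fun _ => rfl
    have e3 : ∀ j, (M.networkG p).cap .s (.buyer'' j) = M.demandTwo p j := fun _ => rfl
    have e4 : ∀ i, (M.networkG p).cap .s (.object i) = 0 := fun _ => rfl
    rw [sum_vertexG]
    simp [hs, e1, e2, e3, e4]
  have h1 : ∀ j : N, ∑ w, (if VertexG.buyer' j ∈ C ∧ w ∉ C then
      (M.networkG p).cap (.buyer' j) w else 0) = if VertexG.buyer' j ∈ C then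
        ∑ i ∈ M.tierOne p j, if VertexG.object i ∈ C then 0 else M.supply i else 0 := by
    intro j
    have e : ∀ i, (M.networkG p).cap (.buyer' j) (.object i) =
      if i ∈ M.tierOne p j then M.supply i else 0 := fun _ => rfl
    rw [sum_vertexG, hsum (M.tierOne p j)]
    simp only [e, networkG_cap_from_buyer', ne_eq, reduceCtorEq, not_false_eq_true, implies_true,
      ite_self, Finset.sum_const_zero, zero_add]
    by_cases hj : VertexG.buyer' j ∈ C
    · rw [if_pos hj]
      exact Finset.sum_congr rfl fun i _ => by by_cases hi : VertexG.object i ∈ C <;> simp [hi, hj]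
    · simp [hj]
  have h2 : ∀ j : N, ∑ w, (if VertexG.buyer'' j ∈ C ∧ w ∉ C then
      (M.networkG p).cap (.buyer'' j) w else 0) = if VertexG.buyer'' j ∈ C then
        ∑ i ∈ M.tierTwo p j, if VertexG.object i ∈ C then 0 else
          min (M.supply i) (M.demandTwo p j) else 0 := by
    intro j
    have e : ∀ i, (M.networkG p).cap (.buyer'' j) (.object i) =
      if i ∈ M.tierTwo p j then min (M.supply i) (M.demandTwo p j) else 0 := fun _ => rfl
    rw [sum_vertexG, hsum (M.tierTwo p j)]
    simp only [e, networkG_cap_from_buyer'', ne_eq, reduceCtorEq, not_false_eq_true, implies_true,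
      ite_self, Finset.sum_const_zero, zero_add]
    by_cases hj : VertexG.buyer'' j ∈ C
    · rw [if_pos hj]
      exact Finset.sum_congr rfl fun i _ => by by_cases hi : VertexG.object i ∈ C <;> simp [hi, hj]
    · simp [hj]
  have h3 : ∀ i : Ω, ∑ w, (if VertexG.object i ∈ C ∧ w ∉ C then
      (M.networkG p).cap (.object i) w else 0) =
        if VertexG.object i ∈ C then M.supply i else 0 := by
    intro i
    have e : (M.networkG p).cap (.object i) .t = M.supply i := rfl
    rw [sum_vertexG]
    simp [networkG_cap_from_object, e, ht]
  rw [FlowNetwork.cutCapacity_eq_sum, sum_vertexG]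
  simp only [h0, h1, h2, h3, ht, false_and, if_false, Finset.sum_const_zero, zero_add]
  have h4 : ∀ (P : N → Prop) [DecidablePred P] (f g : N → ℕ), ∑ j, (if P j then f j else g j) =
      ∑ j, (if P j then 0 else g j) + ∑ j, if P j then f j else 0 := fun P _ f g => by
    rw [← Finset.sum_add_distrib]
    exact Finset.sum_congr rfl fun j _ => by split_ifs <;> simp
  have h5 := h4 (fun j => VertexG.buyer' j ∈ C)
    (fun j => ∑ i ∈ M.tierOne p j, if VertexG.object i ∈ C then 0 else M.supply i) (M.demandOne p)
  have h6 := h4 (fun j => VertexG.buyer'' j ∈ C)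
    (fun j => ∑ i ∈ M.tierTwo p j, if VertexG.object i ∈ C then 0 else
      min (M.supply i) (M.demandTwo p j)) (M.demandTwo p)
  beta_reduce at h5 h6
  rw [h5, h6]
  ring

theorem sum_sdiff_eq_sum_ite {ι : Type*} [DecidableEq ι] (s t : Finset ι) (f : ι → ℕ) :
    ∑ i ∈ s \ t, f i = ∑ i ∈ s, if i ∈ t then 0 else f i := by
  rw [← Finset.filter_notMem_eq_sdiff, Finset.sum_filter]
  exact Finset.sum_congr rfl fun i _ => by split_ifs <;> simp_all

theorem min_sum_le_sum_min {ι : Type*} (s : Finset ι) (f : ι → ℕ) (d : ℕ) :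
    min d (∑ i ∈ s, f i) ≤ ∑ i ∈ s, min (f i) d := by
  classical
  induction s using Finset.induction_on with
  | empty => simp
  | insert a s ha ih =>
    rw [Finset.sum_insert ha, Finset.sum_insert ha]
    omega

open scoped Classical in
theorem outsideDemand_le_cutCapacity (M : Market Ω N) (p : Ω → ℝ) {C : Finset (VertexG Ω N)}
    (hC : (M.networkG p).IsCut C) {S : Finset Ω} (hS : ∀ i, i ∈ S ↔ VertexG.object i ∈ C) :
    ∑ i ∈ S, M.supply i + ∑ j, M.outsideDemand p j S ≤ (M.networkG p).cutCapacity C := by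
  have h1 : ∀ j, ∑ i ∈ M.tierOne p j \ S, M.supply i ≤ M.demandOne p j := fun j =>
    Finset.sum_le_sum_of_subset Finset.sdiff_subset
  rw [networkG_cutCapacity M p hC, add_comm]
  simp only [← hS, ← sum_sdiff_eq_sum_ite, outsideDemand, Finset.sum_add_distrib]
  gcongr with j _ j _
  · split_ifs
    · exact le_rfl
    · exact h1 j
  · split_ifs
    · exact min_sum_le_sum_min _ _ _
    · exact min_le_left _ _
  · rw [Finset.sum_ite_mem, Finset.univ_inter]

open scoped Classical in
/-- The bound for the capacity of cuts with objects `S` is attained. -/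
theorem exists_cutCapacity_le (M : Market Ω N) (p : Ω → ℝ) (S : Finset Ω) :
    ∃ D, (M.networkG p).IsCut D ∧ (∀ i, i ∈ S ↔ VertexG.object i ∈ D) ∧
      (M.networkG p).cutCapacity D ≤ ∑ i ∈ S, M.supply i + ∑ j, M.outsideDemand p j S := by
  let P : VertexG Ω N → Prop := fun
    | .s => True
    | .t => False
    | .buyer' _ => True
    | .buyer'' j => ∑ i ∈ M.tierTwo p j \ S, M.supply i < M.demandTwo p j
    | .object i => i ∈ S
  let D : Finset (VertexG Ω N) := {v | P v}
  have hD : ∀ v, v ∈ D ↔ P v := fun v => by simp [D]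
  have hcut : (M.networkG p).IsCut D := ⟨(hD _).2 trivial, fun h => (hD _).1 h⟩
  have hobj : ∀ i, VertexG.object i ∈ D ↔ i ∈ S := fun i => hD _
  have hb1 : ∀ j, VertexG.buyer' j ∈ D := fun j => (hD _).2 trivial
  have hb2 : ∀ j, VertexG.buyer'' j ∈ D ↔
      ∑ i ∈ M.tierTwo p j \ S, M.supply i < M.demandTwo p j := fun j => hD _
  refine ⟨D, hcut, fun i => (hobj i).symm, ?_⟩
  rw [networkG_cutCapacity M p hcut, add_comm (∑ i ∈ S, M.supply i)]
  simp only [hobj, hb1, if_true, ← sum_sdiff_eq_sum_ite, outsideDemand, Finset.sum_add_distrib]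
  gcongr with j _
  · split_ifs with h
    · rw [hb2] at h
      rw [min_eq_right h.le]
      exact Finset.sum_le_sum fun i _ => min_le_left _ _
    · rw [hb2, not_lt] at h
      exact (min_eq_left h).ge
  · rw [Finset.sum_ite_mem, Finset.univ_inter]

/-! ### The price-raising algorithm -/

/-- The price step does not overshoot a competitive price vector. -/
theorem PriceStep.le_of_isCompetitive {M : Market Ω N} {p q r : Ω → ℝ} (h : M.PriceStep p q)
    (hp : ∃ n : Ω → ℕ, ∀ i, p i = n i) (hr : M.IsCompetitive r) (hpr : ∀ i, p i ≤ r i) (i : Ω) :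
    q i ≤ r i := by
  classical
  obtain ⟨n, hn⟩ := hp
  obtain ⟨-, C, hC, hq⟩ := h
  obtain ⟨x, ⟨hx1, -⟩, hx2⟩ := hr.2
  have hle : ∀ i, p i ≤ (⌊r i⌋ : ℝ) := fun i => by
    have := hpr i
    rw [hn] at this ⊢
    exact_mod_cast Int.le_floor.2 (by exact_mod_cast this)
  let S : Finset Ω := {i | VertexG.object i ∈ C}
  have hS : ∀ i, i ∈ S ↔ VertexG.object i ∈ C := fun i => by simp [S]
  let A : Finset Ω := {i | i ∈ S ∧ (⌊r i⌋ : ℝ) = p i}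
  have hA : ∀ i, i ∈ A ↔ i ∈ S ∧ (⌊r i⌋ : ℝ) = p i := fun i => by simp [A]
  obtain ⟨D, hD1, hD2, hD3⟩ := M.exists_cutCapacity_le p (S \ A)
  have hb : ∑ j, M.outsideDemand p j (S \ A) ≤
      ∑ j, M.outsideDemand p j S + ∑ i ∈ A, M.supply i := by
    calc ∑ j, M.outsideDemand p j (S \ A)
        ≤ ∑ j, (M.outsideDemand p j S + ∑ i ∈ A, x i j) :=
          Finset.sum_le_sum fun j _ => outsideDemand_sdiff_le
            (M.preferredBundles_subset_floor r j (hx2 j)) hle (fun i hi => ((hA i).1 hi).2)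
            fun i hi hiA => lt_of_le_of_ne (hle i) fun h => hiA ((hA i).2 ⟨hi, h.symm⟩)
      _ = ∑ j, M.outsideDemand p j S + ∑ i ∈ A, ∑ j, x i j := by
          rw [Finset.sum_add_distrib, Finset.sum_comm (s := A)]
      _ ≤ _ := by gcongr with i; exact hx1 i
  have hsupply : ∑ i ∈ S \ A, M.supply i + ∑ i ∈ A, M.supply i = ∑ i ∈ S, M.supply i :=
    Finset.sum_sdiff fun i hi => ((hA i).1 hi).1
  have hCS := M.outsideDemand_le_cutCapacity p hC.1.1 hS
  have hCD := hC.subset hD1 (by omega)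
  rw [hq]
  split_ifs with hi
  · have hiA : i ∉ A := (Finset.mem_sdiff.1 ((hD2 i).2 (hCD hi))).2
    have hlt : p i < (⌊r i⌋ : ℝ) :=
      lt_of_le_of_ne (hle i) fun h => hiA ((hA i).2 ⟨(hS i).2 hi, h.symm⟩)
    refine le_trans ?_ (Int.floor_le (r i))
    rw [hn] at hlt ⊢
    have : (n i : ℤ) < ⌊r i⌋ := by exact_mod_cast hlt
    exact_mod_cast this
  · simpa using hpr i

theorem PriceStep.exists_nat {M : Market Ω N} {p q : Ω → ℝ} (h : M.PriceStep p q)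
    (hp : ∃ n : Ω → ℕ, ∀ i, p i = n i) : ∃ n : Ω → ℕ, ∀ i, q i = n i := by
  classical
  obtain ⟨n, hn⟩ := hp
  obtain ⟨-, C, -, hq⟩ := h
  exact ⟨fun i => n i + if VertexG.object i ∈ C then 1 else 0, fun i => by
    rw [hq, hn]
    push_cast
    rfl⟩

/-- By the max-flow min-cut theorem, every price step raises some price. -/
theorem PriceStep.sum_add_one_le {M : Market Ω N} {p q : Ω → ℝ} (h : M.PriceStep p q) :
    ∑ i, p i + 1 ≤ ∑ i, q i := by
  classical
  obtain ⟨⟨f, hf, hlt⟩, C, hC, hq⟩ := h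
  obtain ⟨S, hS, hSf⟩ := hf.exists_cut (by simp [networkG])
  have hcap : (M.networkG p).cutCapacity C < (M.networkG p).sourceCapacity := by
    have := hC.1.2 S hS
    omega
  have hex : ∃ i : Ω, VertexG.object i ∈ C := by
    by_contra! hno
    have h1 := M.outsideDemand_le_cutCapacity p hC.1.1 (S := ∅) (by simp [hno])
    have h2 : ∀ j, M.outsideDemand p j ∅ = M.demandOne p j + M.demandTwo p j := fun j => by
      simp only [outsideDemand, Finset.sdiff_empty]
      have hmin : M.demandTwo p j ≤ ∑ i ∈ M.tierTwo p j, M.supply i := min_le_left _ _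
      rw [min_eq_left hmin]
      rfl
    simp only [h2, Finset.sum_add_distrib, Finset.sum_empty, zero_add] at h1
    rw [networkG_sourceCapacity] at hcap
    omega
  obtain ⟨i₀, hi₀⟩ := hex
  simp only [hq, Finset.sum_add_distrib]
  have : (1 : ℝ) ≤ ∑ i : Ω, if VertexG.object (N := N) i ∈ C then (1 : ℝ) else 0 := by
    refine le_trans ?_ (Finset.single_le_sum (f := fun i : Ω =>
      if VertexG.object (N := N) i ∈ C then (1 : ℝ) else 0) (fun i _ => ?_) (Finset.mem_univ i₀))
    · simp [hi₀]
    · split_ifs <;> simp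
  linarith

theorem networkG_value (M : Market Ω N) (p : Ω → ℝ) {f : VertexG Ω N → VertexG Ω N → ℕ}
    (hf : (M.networkG p).IsFlow f) : (M.networkG p).value f =
      ∑ j, (f .s (.buyer' j) : ℤ) + ∑ j, (f .s (.buyer'' j) : ℤ) := by
  have h0 : ∀ u w, (M.networkG p).cap u w = 0 → f u w = 0 := fun u w h => by
    have := hf.1 u w
    omega
  have h1 : ∀ v, f v .s = 0 := fun v => h0 _ _ (M.networkG_cap_to_s p v)
  have h2 : f .s .t = 0 := h0 _ _ rfl
  have h3 : ∀ i, f .s (.object i) = 0 := fun i => h0 _ _ rfl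
  have h4 : ∀ g : VertexG Ω N → VertexG Ω N → ℕ, (M.networkG p).value g =
    ∑ w, (g .s w : ℤ) - ∑ w, (g w .s : ℤ) := fun _ => rfl
  rw [h4, sum_vertexG]
  simp [h1, h2, h3]

theorem priceStop_or_priceStep (M : Market Ω N) (p : Ω → ℝ) :
    M.PriceStop p ∨ ∃ q, M.PriceStep p q := by
  classical
  obtain ⟨f, hf⟩ := (M.networkG p).exists_isMaxFlow
  have hle : (M.networkG p).value f ≤ ((M.networkG p).sourceCapacity : ℤ) := by
    rw [M.networkG_value p hf.1, networkG_sourceCapacity]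
    push_cast
    gcongr with j _ j _
    · exact hf.1.1 .s (.buyer' j)
    · exact hf.1.1 .s (.buyer'' j)
  rcases hle.eq_or_lt with h | h
  · exact Or.inl ⟨f, hf, h⟩
  · obtain ⟨C, hC⟩ := (M.networkG p).exists_isLeftmostMinCut (by simp [networkG])
    exact Or.inr ⟨fun i => p i + if VertexG.object i ∈ C then 1 else 0, ⟨f, hf, h⟩, C, hC,
      fun i => rfl⟩

/-- A flow that saturates the arcs leaving the source is a stable allocation. -/
theorem PriceStop.exists_isStable {M : Market Ω N} {p : Ω → ℝ} (h : M.PriceStop p) :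
    ∃ x, M.IsStable p x := by
  classical
  obtain ⟨f, ⟨hf, -⟩, hval⟩ := h
  have h0 : ∀ u w, (M.networkG p).cap u w = 0 → f u w = 0 := fun u w h => by
    have := hf.1 u w
    omega
  rw [M.networkG_value p hf, networkG_sourceCapacity] at hval
  have hle1 : ∀ j, f .s (.buyer' j) ≤ M.demandOne p j := fun j => hf.1 .s (.buyer' j)
  have hle2 : ∀ j, f .s (.buyer'' j) ≤ M.demandTwo p j := fun j => hf.1 .s (.buyer'' j)
  have hsum1 := Finset.sum_le_sum fun j (_ : j ∈ Finset.univ) => hle1 j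
  have hsum2 := Finset.sum_le_sum fun j (_ : j ∈ Finset.univ) => hle2 j
  have hval' : ∑ j, f .s (.buyer' j) + ∑ j, f .s (.buyer'' j) =
    ∑ j, M.demandOne p j + ∑ j, M.demandTwo p j := by exact_mod_cast hval
  have hs1 : ∀ j, f .s (.buyer' j) = M.demandOne p j := fun j =>
    (Finset.sum_eq_sum_iff_of_le fun j _ => hle1 j).1 (by omega) j (Finset.mem_univ j)
  have hs2 : ∀ j, f .s (.buyer'' j) = M.demandTwo p j := fun j =>
    (Finset.sum_eq_sum_iff_of_le fun j _ => hle2 j).1 (by omega) j (Finset.mem_univ j)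
  have hc1 : ∀ j, ∑ i, f (.buyer' j) (.object i) = M.demandOne p j := fun j => by
    have := hf.2 (.buyer' j) (by simp [networkG]) (by simp [networkG])
    have hin : ∀ v, v ≠ .s → f v (.buyer' j) = 0 := fun v hv =>
      h0 _ _ (M.networkG_cap_to_buyer' p j hv)
    have hout : ∀ v, (∀ i, v ≠ .object i) → f (.buyer' j) v = 0 := fun v hv =>
      h0 _ _ (M.networkG_cap_from_buyer' p j hv)
    rw [sum_vertexG, sum_vertexG] at this
    simp [hin, hout, hs1] at this
    exact this.symm
  have hc2 : ∀ j, ∑ i, f (.buyer'' j) (.object i) = M.demandTwo p j := fun j => by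
    have := hf.2 (.buyer'' j) (by simp [networkG]) (by simp [networkG])
    have hin : ∀ v, v ≠ .s → f v (.buyer'' j) = 0 := fun v hv =>
      h0 _ _ (M.networkG_cap_to_buyer'' p j hv)
    have hout : ∀ v, (∀ i, v ≠ .object i) → f (.buyer'' j) v = 0 := fun v hv =>
      h0 _ _ (M.networkG_cap_from_buyer'' p j hv)
    rw [sum_vertexG, sum_vertexG] at this
    simp [hin, hout, hs2] at this
    exact this.symm
  have hc3 : ∀ i, ∑ j, f (.buyer' j) (.object i) + ∑ j, f (.buyer'' j) (.object i) ≤ M.supply i :=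
    fun i => by
    have := hf.2 (.object i) (by simp [networkG]) (by simp [networkG])
    have hin1 : f .s (.object i) = 0 := h0 _ _ rfl
    have hin2 : f .t (.object i) = 0 := h0 _ _ rfl
    have hin3 : ∀ i', f (.object i') (.object i) = 0 := fun i' => h0 _ _ rfl
    have hout : ∀ v, v ≠ .t → f (.object i) v = 0 := fun v hv =>
      h0 _ _ (M.networkG_cap_from_object p i hv)
    rw [sum_vertexG, sum_vertexG] at this
    simp [hin1, hin2, hin3, hout] at this
    rw [this]
    exact hf.1 (.object i) .t
  have hz1 : ∀ j i, i ∉ M.tierOne p j → f (.buyer' j) (.object i) = 0 := fun j i hi =>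
    h0 _ _ (by simp [networkG, hi])
  have hz2 : ∀ j i, i ∉ M.tierTwo p j → f (.buyer'' j) (.object i) = 0 := fun j i hi =>
    h0 _ _ (by simp [networkG, hi])
  have hfull : ∀ j, ∀ i ∈ M.tierOne p j, f (.buyer' j) (.object i) = M.supply i := by
    intro j
    refine (Finset.sum_eq_sum_iff_of_le fun i hi => ?_).1 ?_
    · have := hf.1 (.buyer' j) (.object i)
      simpa [networkG, hi] using this
    · refine Eq.trans ?_ (hc1 j)
      exact Finset.sum_subset (Finset.subset_univ _) fun i _ hi => hz1 j i hi
  have hfeas : M.IsFeasible fun i j => f (.buyer' j) (.object i) + f (.buyer'' j) (.object i) := by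
    refine ⟨fun i => ?_, fun j => ?_⟩
    · rw [Finset.sum_add_distrib]
      exact hc3 i
    · rw [Finset.sum_add_distrib, hc1, hc2]
      exact M.demandOne_add_demandTwo_le p j
  refine ⟨_, hfeas, fun j => mem_preferredBundles_iff_tiers.2 ⟨⟨hfeas.2 j, fun i => ?_⟩, ?_, ?_, ?_⟩⟩
  · exact (Finset.single_le_sum (f := fun j => f (.buyer' j) (.object i) +
      f (.buyer'' j) (.object i)) (fun _ _ => Nat.zero_le _) (Finset.mem_univ j)).trans (hfeas.1 i)
  · intro i hi
    rw [hfull j i hi, hz2 j i (Finset.disjoint_left.1 (M.disjoint_tierOne_tierTwo p j) hi), add_zero]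
  · rw [← hc2 j]
    refine Eq.trans (Finset.sum_congr rfl fun i hi => ?_)
      (Finset.sum_subset (Finset.subset_univ _) fun i _ hi => hz2 j i hi)
    rw [hz1 j i (Finset.disjoint_right.1 (M.disjoint_tierOne_tierTwo p j) hi), zero_add]
  · intro i h1 h2 _
    rw [hz1 j i h1, hz2 j i h2]

/-- Prices above all values are competitive, as nobody wants to buy. -/
theorem isCompetitive_of_value_le (M : Market Ω N) {p : Ω → ℝ} (hp : ∀ i, 0 ≤ p i)
    (h : ∀ i j, (M.value i j : ℝ) ≤ p i) : M.IsCompetitive p := by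
  refine ⟨hp, fun _ _ => 0, by simp [IsFeasible], fun j => mem_preferredBundles_iff.2
    ⟨by simp [bundles], 0, le_rfl, fun i hi => ?_, fun _ _ => rfl, fun _ => rfl⟩⟩
  exact absurd (h i j) (not_le.2 (sub_pos.1 hi))

theorem exists_isCompetitive (M : Market Ω N) : ∃ p, M.IsCompetitive p := by
  refine ⟨fun i => ∑ j, (M.value i j : ℝ), M.isCompetitive_of_value_le
    (fun i => Finset.sum_nonneg fun _ _ => Nat.cast_nonneg _) fun i j => ?_⟩
  exact Finset.single_le_sum (f := fun j => (M.value i j : ℝ)) (fun _ _ => Nat.cast_nonneg _)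
    (Finset.mem_univ j)

/-- The invariant of the price-raising algorithm: the prices are integral and below all competitive
prices. -/
theorem priceStep_invariant {M : Market Ω N} {p : Ω → ℝ}
    (h : Relation.ReflTransGen M.PriceStep (fun _ => 0) p) :
    (∃ n : Ω → ℕ, ∀ i, p i = n i) ∧ ∀ r, M.IsCompetitive r → ∀ i, p i ≤ r i := by
  induction h with
  | refl => exact ⟨⟨fun _ => 0, by simp⟩, fun r hr => hr.1⟩
  | tail _ hstep ih =>
    exact ⟨hstep.exists_nat ih.1, fun r hr => hstep.le_of_isCompetitive ih.1 hr (ih.2 r hr)⟩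

theorem not_exists_infinite_priceStep (M : Market Ω N) :
    ¬ ∃ P : ℕ → Ω → ℝ, (∀ i, P 0 i = 0) ∧ ∀ n, M.PriceStep (P n) (P (n + 1)) := by
  rintro ⟨P, h0, hP⟩
  obtain ⟨r, hr⟩ := M.exists_isCompetitive
  have hreach : ∀ n, Relation.ReflTransGen M.PriceStep (fun _ => 0) (P n) := by
    intro n
    induction n with
    | zero => rw [show P 0 = fun _ => 0 from funext h0]
    | succ n ih => exact ih.tail (hP n)
  have hsum : ∀ n : ℕ, (n : ℝ) ≤ ∑ i, P n i := by
    intro n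
    induction n with
    | zero => simp [h0]
    | succ n ih =>
      have := (hP n).sum_add_one_le
      push_cast
      linarith
  obtain ⟨n, hn⟩ := exists_nat_gt (∑ i, r i)
  have := Finset.sum_le_sum fun i (_ : i ∈ Finset.univ) => (priceStep_invariant (hreach n)).2 r hr i
  linarith [hsum n]

theorem exists_priceRaisingReturns (M : Market Ω N) : ∃ p, M.PriceRaisingReturns p := by
  by_contra! hno
  have hnext : ∀ p : {p // Relation.ReflTransGen M.PriceStep (fun _ => 0) p},
      ∃ q : {p // Relation.ReflTransGen M.PriceStep (fun _ => 0) p}, M.PriceStep p q := fun p => by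
    obtain ⟨q, hq⟩ := (M.priceStop_or_priceStep p).resolve_left fun h => hno p ⟨p.2, h⟩
    exact ⟨⟨q, p.2.tail hq⟩, hq⟩
  choose next hnext using hnext
  refine M.not_exists_infinite_priceStep ⟨fun n => (next^[n] ⟨_, .refl⟩).1, fun i => rfl, fun n => ?_⟩
  simp only [Function.iterate_succ_apply']
  exact hnext _

theorem PriceRaisingReturns.isLeast {M : Market Ω N} {p : Ω → ℝ} (h : M.PriceRaisingReturns p) :
    IsLeast {q | M.IsCompetitive q} p := by
  obtain ⟨⟨n, hn⟩, hle⟩ := priceStep_invariant h.1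
  exact ⟨⟨fun i => by rw [hn]; exact Nat.cast_nonneg _, h.2.exists_isStable⟩, fun q hq => hle q hq⟩

end Market

namespace Market

variable {Ω N : Type*} [Fintype Ω] [Fintype N]

/-! ### Selling all objects of positive price -/

/-- An allocation as a flow from the buyers to the objects. -/
def allocationFlow (x : Ω → N → ℕ) : Ω ⊕ N → Ω ⊕ N → ℕ
  | .inr j, .inl i => x i j
  | _, _ => 0

theorem excess_inl {g : Ω ⊕ N → Ω ⊕ N → ℕ} {x : Ω → N → ℕ} (hg : g = allocationFlow x) (i : Ω) :
    FlowNetwork.excess g (.inl i) = ∑ j, (x i j : ℤ) := by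
  simp [FlowNetwork.excess, hg, allocationFlow]

theorem excess_inr {g : Ω ⊕ N → Ω ⊕ N → ℕ} {x : Ω → N → ℕ} (hg : g = allocationFlow x) (j : N) :
    FlowNetwork.excess g (.inr j) = - ∑ i, (x i j : ℤ) := by
  simp [FlowNetwork.excess, hg, allocationFlow]

open scoped Classical in
/-- The residual graph of an allocation `x` with thresholds `c`: only the items whose payoff equals
the threshold may be exchanged. -/
def ExchangeArc (M : Market Ω N) (p : Ω → ℝ) (c : N → ℝ) (x : Ω → N → ℕ) : Ω ⊕ N → Ω ⊕ N → Prop :=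
  FlowNetwork.Residual
    (allocationFlow fun i j => if c j < M.payoff p j i then M.supply i else 0)
    (allocationFlow fun i j => if c j ≤ M.payoff p j i then M.supply i else 0)
    (allocationFlow x)

open scoped Classical in
/-- Exchanges along a path to an undersold object `i₀` preserve stability. -/
theorem IsStable.exists_exchange {M : Market Ω N} {p : Ω → ℝ} {c : N → ℝ} {x : Ω → N → ℕ}
    (hx : M.IsStable p x) (hc : ∀ j, M.IsThreshold p j (fun i => x i j) (c j)) {i₀ : Ω}
    (hi₀ : ∑ j, x i₀ j < M.supply i₀) {a : Ω ⊕ N}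
    (ha : Relation.ReflTransGen (M.ExchangeArc p c x) a (.inl i₀))
    (haj : ∀ j, a = .inr j → ∑ i, x i j < M.demand j) :
    ∃ x', M.IsStable p x' ∧ ∀ i, ∑ j, (x' i j : ℤ) =
      ∑ j, (x i j : ℤ) + (if i = i₀ then 1 else 0) - if a = .inl i then 1 else 0 := by
  have hxb : ∀ i j, x i j ≤ M.supply i := fun i j => (hx.2 j).1.2 i
  obtain ⟨g, hg1, hg2, hg3⟩ := FlowNetwork.exists_push (by
    intro u w
    rcases u with i | j <;> rcases w with i' | j' <;> simp only [allocationFlow, le_refl]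
    split_ifs with h
    · exact ((hc j).2.1 i' h).ge
    · exact Nat.zero_le _) (by
    intro u w
    rcases u with i | j <;> rcases w with i' | j' <;> simp only [allocationFlow, le_refl]
    split_ifs with h
    · exact hxb i' j
    · exact ((hc j).2.2.1 i' (not_le.1 h)).le) ha
  have hgx : g = allocationFlow fun i j => g (.inr j) (.inl i) := by
    funext u w
    have := hg2 u w
    rcases u with i | j <;> rcases w with i' | j' <;> simp_all [allocationFlow]
  set x' : Ω → N → ℕ := fun i j => g (.inr j) (.inl i) with hx'
  have hsold : ∀ i, ∑ j, (x' i j : ℤ) =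
      ∑ j, (x i j : ℤ) + (if i = i₀ then 1 else 0) - if a = .inl i then 1 else 0 := fun i => by
    rw [← excess_inl hgx, hg3, excess_inl rfl]
    simp [eq_comm]
  have hdem : ∀ j, ∑ i, (x' i j : ℤ) = ∑ i, (x i j : ℤ) + if a = .inr j then 1 else 0 := fun j => by
    have := hg3 (.inr j)
    rw [excess_inr hgx, excess_inr rfl] at this
    simp only [reduceCtorEq, if_false, add_zero, eq_comm (a := Sum.inr j)] at this
    linarith
  have hle : ∀ i j, x' i j ≤ M.supply i := fun i j => by
    have := hg2 (.inr j) (.inl i)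
    simp only [allocationFlow] at this
    split_ifs at this
    · exact this
    · exact this.trans (Nat.zero_le _)
  have hfeas : M.IsFeasible x' := by
    refine ⟨fun i => ?_, fun j => ?_⟩
    · zify
      rw [hsold]
      have := hx.1.1 i
      zify at this hi₀
      by_cases hi : i = i₀
      · subst hi
        simp only [if_true]
        split_ifs <;> omega
      · simp only [hi, if_false]
        split_ifs <;> omega
    · zify
      rw [hdem]
      have := hx.1.2 j
      split_ifs with h
      · have := haj j h
        zify at this
        omega
      · zify at this
        omega
  refine ⟨x', ⟨hfeas, fun j => mem_preferredBundles_iff.2 ⟨⟨hfeas.2 j, fun i => hle i j⟩, c j,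
    (hc j).1, fun i hi => ?_, fun i hi => ?_, fun h => (hc j).2.2.2 ?_⟩⟩, hsold⟩
  · have := hg1 (.inr j) (.inl i)
    simp only [allocationFlow, hi, if_true] at this
    exact le_antisymm (hle i j) this
  · have := hg2 (.inr j) (.inl i)
    simp only [allocationFlow, not_le.2 hi, if_false] at this
    exact Nat.le_zero.1 this
  · have h' := hdem j
    zify at h ⊢
    split_ifs at h' <;> omega

/-- If no object of price zero and no buyer with residual demand is connected by exchanges to `i₀`,
then the prices of all objects that are connected to `i₀` can be lowered by one. -/
theorem IsStable.isCompetitive_lower {M : Market Ω N} {p : Ω → ℝ} {n : Ω → ℕ} {k : N → ℤ}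
    {x : Ω → N → ℕ} (hx : M.IsStable p x) (hn : ∀ i, p i = n i)
    (hc : ∀ j, M.IsThreshold p j (fun i => x i j) (k j)) {i₀ : Ω}
    (hobj : ∀ i, Relation.ReflTransGen (M.ExchangeArc p (fun j => k j) x) (.inl i) (.inl i₀) →
      0 < p i)
    (hbuy : ∀ j, Relation.ReflTransGen (M.ExchangeArc p (fun j => k j) x) (.inr j) (.inl i₀) →
      M.demand j ≤ ∑ i, x i j) :
    ∃ q, M.IsCompetitive q ∧ q i₀ < p i₀ := by
  classical
  set R : Ω ⊕ N → Prop := fun v =>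
    Relation.ReflTransGen (M.ExchangeArc p (fun j => k j) x) v (.inl i₀) with hR
  let q : Ω → ℝ := fun i => p i - if R (.inl i) then 1 else 0
  have hpay : ∀ j i, M.payoff p j i = ((M.value i j - n i : ℤ) : ℝ) := fun j i => by
    simp [payoff, hn]
  have hpayq : ∀ j i, M.payoff q j i =
      ((M.value i j - n i + (if R (.inl i) then 1 else 0) : ℤ) : ℝ) := fun j i => by
    simp only [payoff, hn, q]
    push_cast
    ring
  -- The two closure properties of `R`: no exchange arc enters it.
  have h1 : ∀ i j, R (.inr j) → ¬ R (.inl i) → (M.value i j - n i : ℤ) = k j → x i j = 0 := by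
    intro i j hj hi heq
    by_contra hne
    refine hi (Relation.ReflTransGen.head (Or.inr ?_) hj)
    simp only [allocationFlow, hpay, heq, lt_irrefl, if_false]
    omega
  have h2 : ∀ i j, R (.inl i) → ¬ R (.inr j) → (M.value i j - n i : ℤ) = k j →
      x i j = M.supply i := by
    intro i j hi hj heq
    by_contra hne
    refine hj (Relation.ReflTransGen.head (Or.inl ?_) hi)
    simp only [allocationFlow, hpay, heq, le_refl, if_true]
    exact lt_of_le_of_ne ((hx.2 j).1.2 i) hne
  refine ⟨q, ⟨fun i => ?_, x, hx.1, fun j => mem_preferredBundles_iff.2 ⟨(hx.2 j).1,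
    ((k j + if R (.inr j) then 1 else 0 : ℤ) : ℝ), ?_, fun i hi => ?_, fun i hi => ?_, fun h => ?_⟩⟩, ?_⟩
  · by_cases hi : R (.inl i)
    · have := hobj i hi
      simp only [q, hi, if_true]
      rw [hn] at this ⊢
      have : 1 ≤ n i := by exact_mod_cast this
      rw [sub_nonneg]
      exact_mod_cast this
    · simp [q, hi, hn]
  · have := (hc j).1
    rw [Int.cast_nonneg_iff] at this ⊢
    split_ifs <;> omega
  · rw [hpayq, Int.cast_lt] at hi
    have h3 := (hc j).2.1 i
    rw [hpay, Int.cast_lt] at h3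
    have h4 := h2 i j
    by_cases hRi : R (.inl i) <;> by_cases hRj : R (.inr j) <;>
      simp only [hRi, hRj, if_true, if_false] at hi h4
    · exact h3 (by omega)
    · rcases eq_or_ne (M.value i j - n i : ℤ) (k j) with h | h
      · exact h4 trivial (by simp) h
      · exact h3 (by omega)
    · exact h3 (by omega)
    · exact h3 (by omega)
  · rw [hpayq, Int.cast_lt] at hi
    have h3 := (hc j).2.2.1 i
    rw [hpay, Int.cast_lt] at h3
    have h4 := h1 i j
    by_cases hRi : R (.inl i) <;> by_cases hRj : R (.inr j) <;>
      simp only [hRi, hRj, if_true, if_false] at hi h4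
    · exact h3 (by omega)
    · exact h3 (by omega)
    · rcases eq_or_ne (M.value i j - n i : ℤ) (k j) with h | h
      · exact h4 trivial (by simp) h
      · exact h3 (by omega)
    · exact h3 (by omega)
  · have h3 := (hc j).2.2.2 h
    have hRj : ¬ R (.inr j) := fun hj => absurd (hbuy j hj) (not_le.2 h)
    simpa [hRj] using h3
  · have : R (.inl i₀) := Relation.ReflTransGen.refl
    simp [q, this]

/-- At the least competitive prices, some stable allocation sells all items of positive price, and
leaves no item unsold if there is residual demand. -/
theorem exists_isStable_sold {M : Market Ω N} {p : Ω → ℝ} {n : Ω → ℕ}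
    (hp : IsLeast {q | M.IsCompetitive q} p) (hn : ∀ i, p i = n i) :
    ∃ x, M.IsStable p x ∧ (∀ i, 0 < p i → ∑ j, x i j = M.supply i) ∧
      ∀ i j, ∑ j, x i j = M.supply i ∨ ∑ i, x i j = M.demand j := by
  classical
  -- With weight two for positive prices, exchanging an item of price zero for one of positive price
  -- is an improvement, as is selling an additional item.
  let w : Ω → ℤ := fun i => if 0 < p i then 2 else 1
  have hfin : Set.Finite {x | M.IsStable p x} :=
    (Set.Finite.pi' fun i => Set.Finite.pi' fun _ => Set.finite_Iic (M.supply i)).subset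
      fun x hx i j => (hx.2 j).1.2 i
  obtain ⟨x, hx, hmax⟩ := hfin.exists_maximalFor (fun x => ∑ i, w i * ∑ j, (x i j : ℤ)) _ hp.1.2
  have hx : M.IsStable p x := hx
  have hthr : ∀ j, ∃ k : ℤ, M.IsThreshold p j (fun i => x i j) (k : ℝ) := fun j => by
    obtain ⟨-, c, hc⟩ := mem_preferredBundles_iff.1 (hx.2 j)
    have := hc.floor
    rw [show (fun i => (⌊p i⌋ : ℝ)) = p from funext fun i => by simp [hn]] at this
    exact ⟨_, this⟩
  choose k hk using hthr
  -- No exchange increases the weight of the items sold.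
  have hopt : ∀ (i₀ : Ω) (a : Ω ⊕ N), ∑ j, x i₀ j < M.supply i₀ →
      Relation.ReflTransGen (M.ExchangeArc p (fun j => k j) x) a (.inl i₀) →
      (∀ j, a = .inr j → ∑ i, x i j < M.demand j) →
      w i₀ ≤ ∑ i, w i * if a = .inl i then 1 else 0 := by
    intro i₀ a h1 h2 h3
    obtain ⟨x', hx', hs⟩ := hx.exists_exchange hk h1 h2 h3
    by_contra! hlt
    have hsum : ∑ i, w i * ∑ j, (x' i j : ℤ) =
        ∑ i, w i * ∑ j, (x i j : ℤ) + w i₀ - ∑ i, w i * if a = .inl i then 1 else 0 := by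
      simp only [hs, mul_sub, mul_add, Finset.sum_sub_distrib, Finset.sum_add_distrib]
      simp
    have := hmax hx' (by simp only; omega)
    simp only at this
    omega
  have hw : ∀ i, 1 ≤ w i := fun i => by
    simp only [w]
    split_ifs <;> omega
  have hbuy : ∀ (i₀ : Ω) (j : N), ∑ j, x i₀ j < M.supply i₀ →
      Relation.ReflTransGen (M.ExchangeArc p (fun j => k j) x) (.inr j) (.inl i₀) →
      M.demand j ≤ ∑ i, x i j := by
    intro i₀ j h1 h2
    by_contra! hlt
    have := hopt i₀ (.inr j) h1 h2 (by rintro _ ⟨⟩; exact hlt)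
    simp only [reduceCtorEq, if_false, mul_zero, Finset.sum_const_zero] at this
    have := hw i₀
    omega
  have hpos : ∀ i, 0 < p i → ∑ j, x i j = M.supply i := by
    intro i₀ hi₀
    by_contra hne
    have hlt := lt_of_le_of_ne (hx.1.1 i₀) hne
    obtain ⟨q, hq, hqp⟩ := hx.isCompetitive_lower hn hk (i₀ := i₀) (fun i hi => by
      by_contra h0
      have := hopt i₀ (.inl i) hlt hi (by simp)
      simp [w, h0, hi₀] at this) (fun j => hbuy i₀ j hlt)
    exact absurd (hp.2 hq i₀) (not_le.2 hqp)
  refine ⟨x, hx, hpos, fun i j => ?_⟩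
  by_contra! hne
  have hi := lt_of_le_of_ne (hx.1.1 i) hne.1
  have hj := lt_of_le_of_ne (hx.1.2 j) hne.2
  have hxi : x i j < M.supply i :=
    (Finset.single_le_sum (f := fun j => x i j) (fun _ _ => Nat.zero_le _) (Finset.mem_univ j)).trans_lt
      hi
  have hp0 : p i = 0 := by
    refine le_antisymm (not_lt.1 fun h => hne.1 (hpos i h)) (hp.1.1 i)
  have hpay : M.payoff p j i = 0 := by
    refine le_antisymm (not_lt.1 fun h => hxi.ne ((hk j).2.1 i ?_)) (by simp [payoff, hp0])
    rw [(hk j).2.2.2 hj]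
    exact h
  refine absurd (hbuy i j hi (.single (Or.inl ?_))) (not_le.2 hj)
  simp only [allocationFlow, hpay, (hk j).2.2.2 hj, le_refl, if_true]
  exact hxi

end Market

namespace Market

variable {Ω N : Type*} [Fintype Ω]

/-! ### The network with three tiers -/

theorem extendedNetwork_cap_to_s (M : Market Ω N) (p : Ω → ℝ) (v : VertexH Ω N) :
    (M.extendedNetwork p).cap v .s = 0 := by
  cases v <;> rfl

theorem extendedNetwork_cap_to_buyer (M : Market Ω N) (p : Ω → ℝ) (j : N) {v : VertexH Ω N}
    (hv : v ≠ .s) : (M.extendedNetwork p).cap v (.buyer' j) = 0 ∧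
      (M.extendedNetwork p).cap v (.buyer'' j) = 0 ∧
      (M.extendedNetwork p).cap v (.buyer''' j) = 0 := by
  cases v
  case s => exact absurd rfl hv
  all_goals exact ⟨rfl, rfl, rfl⟩

theorem extendedNetwork_cap_from_buyer (M : Market Ω N) (p : Ω → ℝ) (j : N) {v : VertexH Ω N}
    (hv : ∀ i, v ≠ .object i) : (M.extendedNetwork p).cap (.buyer' j) v = 0 ∧
      (M.extendedNetwork p).cap (.buyer'' j) v = 0 ∧
      (M.extendedNetwork p).cap (.buyer''' j) v = 0 := by
  cases v
  case object i => exact absurd rfl (hv i)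
  all_goals exact ⟨rfl, rfl, rfl⟩

theorem extendedNetwork_cap_from_object (M : Market Ω N) (p : Ω → ℝ) (i : Ω) {v : VertexH Ω N}
    (hv : v ≠ .t) : (M.extendedNetwork p).cap (.object i) v = 0 := by
  cases v
  case t => exact absurd rfl hv
  all_goals rfl

variable [Fintype N]

theorem sum_vertexH {A : Type*} [AddCommMonoid A] (F : VertexH Ω N → A) :
    ∑ v, F v = F .s + (F .t + (∑ j, F (.buyer' j) + (∑ j, F (.buyer'' j) +
      (∑ j, F (.buyer''' j) + ∑ i, F (.object i))))) := by
  let e : Option (Option (N ⊕ N ⊕ N ⊕ Ω)) ≃ VertexH Ω N :=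
    { toFun := fun
        | none => .s
        | some none => .t
        | some (some (.inl j)) => .buyer' j
        | some (some (.inr (.inl j))) => .buyer'' j
        | some (some (.inr (.inr (.inl j)))) => .buyer''' j
        | some (some (.inr (.inr (.inr i)))) => .object i
      invFun := fun
        | .s => none
        | .t => some none
        | .buyer' j => some (some (.inl j))
        | .buyer'' j => some (some (.inr (.inl j)))
        | .buyer''' j => some (some (.inr (.inr (.inl j))))
        | .object i => some (some (.inr (.inr (.inr i))))
      left_inv := by rintro (_ | _ | _ | _ | _ | _) <;> rfl
      right_inv := by rintro (_ | _ | _ | _ | _ | _) <;> rfl }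
  rw [← e.sum_comp]
  simp only [Fintype.sum_option, Fintype.sum_sum_type]
  rfl

/-- The allocation given by a flow on the arcs from the buyers to the objects. -/
def tierAllocation (f : VertexH Ω N → VertexH Ω N → ℕ) (i : Ω) (j : N) : ℕ :=
  f (.buyer' j) (.object i) + f (.buyer'' j) (.object i) + f (.buyer''' j) (.object i)

theorem value_extendedNetwork {M : Market Ω N} {p : Ω → ℝ} {f : VertexH Ω N → VertexH Ω N → ℕ}
    (hf : ∀ u w, f u w ≤ (M.extendedNetwork p).cap u w) : (M.extendedNetwork p).value f =
      ∑ j, ((f .s (.buyer' j) : ℤ) + f .s (.buyer'' j) + f .s (.buyer''' j)) := by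
  have h0 : ∀ u w, (M.extendedNetwork p).cap u w = 0 → f u w = 0 := fun u w h => by
    have := hf u w
    omega
  have h1 : ∀ v, f v .s = 0 := fun v => h0 _ _ (M.extendedNetwork_cap_to_s p v)
  have h2 : f .s .t = 0 := h0 _ _ rfl
  have h3 : ∀ i, f .s (.object i) = 0 := fun i => h0 _ _ rfl
  have h4 : (M.extendedNetwork p).value f = ∑ w, (f .s w : ℤ) - ∑ w, (f w .s : ℤ) := rfl
  rw [h4, sum_vertexH]
  simp [h1, h2, h3, Finset.sum_add_distrib, add_assoc]

/-- Flow conservation in the network with three tiers. -/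
theorem isFlow_extendedNetwork_iff {M : Market Ω N} {p : Ω → ℝ}
    {f : VertexH Ω N → VertexH Ω N → ℕ} : (M.extendedNetwork p).IsFlow f ↔
      (∀ u w, f u w ≤ (M.extendedNetwork p).cap u w) ∧
      (∀ j, f .s (.buyer' j) = ∑ i, f (.buyer' j) (.object i)) ∧
      (∀ j, f .s (.buyer'' j) = ∑ i, f (.buyer'' j) (.object i)) ∧
      (∀ j, f .s (.buyer''' j) = ∑ i, f (.buyer''' j) (.object i)) ∧
      ∀ i, ∑ j, tierAllocation f i j = f (.object i) .t := by
  refine and_congr_right fun hf => ?_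
  have h0 : ∀ u w, (M.extendedNetwork p).cap u w = 0 → f u w = 0 := fun u w h => by
    have := hf u w
    omega
  have hin : ∀ j v, v ≠ .s → f v (.buyer' j) = 0 ∧ f v (.buyer'' j) = 0 ∧ f v (.buyer''' j) = 0 :=
    fun j v hv => by
      obtain ⟨h1, h2, h3⟩ := M.extendedNetwork_cap_to_buyer p j hv
      exact ⟨h0 _ _ h1, h0 _ _ h2, h0 _ _ h3⟩
  have hout : ∀ j v, (∀ i, v ≠ .object i) →
      f (.buyer' j) v = 0 ∧ f (.buyer'' j) v = 0 ∧ f (.buyer''' j) v = 0 := fun j v hv => by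
    obtain ⟨h1, h2, h3⟩ := M.extendedNetwork_cap_from_buyer p j hv
    exact ⟨h0 _ _ h1, h0 _ _ h2, h0 _ _ h3⟩
  have hobj : ∀ i v, v ≠ .t → f (.object i) v = 0 := fun i v hv =>
    h0 _ _ (M.extendedNetwork_cap_from_object p i hv)
  have hs : ∀ i, f .s (.object i) = 0 := fun i => h0 _ _ rfl
  have ht : ∀ i, f .t (.object i) = 0 := fun i => h0 _ _ rfl
  have e1 : ∀ j, (∑ u, f u (.buyer' j) = ∑ u, f (.buyer' j) u) ↔
      f .s (.buyer' j) = ∑ i, f (.buyer' j) (.object i) := fun j => by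
    rw [sum_vertexH, sum_vertexH]
    simp [hin, hout]
  have e2 : ∀ j, (∑ u, f u (.buyer'' j) = ∑ u, f (.buyer'' j) u) ↔
      f .s (.buyer'' j) = ∑ i, f (.buyer'' j) (.object i) := fun j => by
    rw [sum_vertexH, sum_vertexH]
    simp [hin, hout]
  have e3 : ∀ j, (∑ u, f u (.buyer''' j) = ∑ u, f (.buyer''' j) u) ↔
      f .s (.buyer''' j) = ∑ i, f (.buyer''' j) (.object i) := fun j => by
    rw [sum_vertexH, sum_vertexH]
    simp [hin, hout]
  have e4 : ∀ i, (∑ u, f u (.object i) = ∑ u, f (.object i) u) ↔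
      ∑ j, tierAllocation f i j = f (.object i) .t := fun i => by
    rw [sum_vertexH, sum_vertexH]
    simp [hs, ht, hobj, tierAllocation, Finset.sum_add_distrib, add_assoc]
  constructor
  · intro h
    exact ⟨fun j => (e1 j).1 (h _ nofun nofun), fun j => (e2 j).1 (h _ nofun nofun),
      fun j => (e3 j).1 (h _ nofun nofun), fun i => (e4 i).1 (h _ nofun nofun)⟩
  · rintro ⟨h1, h2, h3, h4⟩ (_ | _ | j | j | j | i) hws hwt
    · exact absurd rfl hws
    · exact absurd rfl hwt
    · exact (e1 j).2 (h1 j)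
    · exact (e2 j).2 (h2 j)
    · exact (e3 j).2 (h3 j)
    · exact (e4 i).2 (h4 i)

open scoped Classical in
/-- The flow that splits the bundles of an allocation into the tiers. -/
noncomputable def tierFlow (M : Market Ω N) (p : Ω → ℝ) (y : Ω → N → ℕ) :
    VertexH Ω N → VertexH Ω N → ℕ
  | .s, .buyer' j => ∑ i ∈ M.tierOne p j, y i j
  | .s, .buyer'' j => ∑ i ∈ M.tierTwo p j, y i j
  | .s, .buyer''' j => ∑ i ∈ M.tierThree p j, y i j
  | .buyer' j, .object i => if i ∈ M.tierOne p j then y i j else 0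
  | .buyer'' j, .object i => if i ∈ M.tierTwo p j then y i j else 0
  | .buyer''' j, .object i => if i ∈ M.tierThree p j then y i j else 0
  | .object i, .t => ∑ j, y i j
  | _, _ => 0

theorem tierAllocation_tierFlow {M : Market Ω N} {p : Ω → ℝ} {y : Ω → N → ℕ} {j : N}
    (hy : (fun i => y i j) ∈ M.preferredBundles p j) (i : Ω) :
    tierAllocation (M.tierFlow p y) i j = y i j := by
  obtain ⟨-, -, -, h3⟩ := mem_preferredBundles_iff_tiers.1 hy
  have h12 : i ∈ M.tierOne p j → i ∉ M.tierTwo p j :=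
    fun h => Finset.disjoint_left.1 (M.disjoint_tierOne_tierTwo p j) h
  have h13 : i ∈ M.tierOne p j → i ∉ M.tierThree p j := fun h h' =>
    (payoff_pos_of_mem_tierOne h).ne' (mem_tierThree.1 h')
  have h23 : i ∈ M.tierTwo p j → i ∉ M.tierThree p j := fun h h' =>
    (payoff_pos_of_mem_tierTwo h).ne' (mem_tierThree.1 h')
  have h3 := h3 i
  simp only [tierAllocation, tierFlow]
  by_cases h1 : i ∈ M.tierOne p j
  · simp [h1, h12 h1, h13 h1]
  · by_cases h2 : i ∈ M.tierTwo p j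
    · simp [h1, h2, h23 h2]
    · by_cases h4 : i ∈ M.tierThree p j
      · simp [h1, h2, h4]
      · simp [h1, h2, h4, h3 h1 h2 h4]

/-- An allocation of preferred bundles that sells all items and meets all demands is a flow whose
value is the total demand. -/
theorem exists_isFlow_extendedNetwork {M : Market Ω N} {p : Ω → ℝ} {y : Ω → N → ℕ}
    (hy : ∀ j, (fun i => y i j) ∈ M.preferredBundles p j) (hs : ∀ i, ∑ j, y i j = M.supply i)
    (hd : ∀ j, ∑ i, y i j = M.demand j) :
    ∃ g, (M.extendedNetwork p).IsFlow g ∧ (M.extendedNetwork p).value g = ∑ j, (M.demand j : ℤ) := by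
  classical
  have hsum : ∀ (T : Finset Ω) (f : Ω → ℕ), ∑ i, (if i ∈ T then f i else 0) = ∑ i ∈ T, f i :=
    fun T f => by rw [Finset.sum_ite_mem, Finset.univ_inter]
  have hc1 : ∀ j, M.tierFlow p y .s (.buyer' j) =
      ∑ i, M.tierFlow p y (.buyer' j) (.object i) := fun j => (hsum _ _).symm
  have hc2 : ∀ j, M.tierFlow p y .s (.buyer'' j) =
      ∑ i, M.tierFlow p y (.buyer'' j) (.object i) := fun j => (hsum _ _).symm
  have hc3 : ∀ j, M.tierFlow p y .s (.buyer''' j) =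
      ∑ i, M.tierFlow p y (.buyer''' j) (.object i) := fun j => (hsum _ _).symm
  have htot : ∀ j, M.tierFlow p y .s (.buyer' j) + M.tierFlow p y .s (.buyer'' j) +
      M.tierFlow p y .s (.buyer''' j) = M.demand j := fun j => by
    rw [hc1, hc2, hc3, ← Finset.sum_add_distrib, ← Finset.sum_add_distrib, ← hd j]
    exact Finset.sum_congr rfl fun i _ => tierAllocation_tierFlow (hy j) i
  have hcap : ∀ u w, M.tierFlow p y u w ≤ (M.extendedNetwork p).cap u w := by
    have h1 : ∀ j, M.tierFlow p y .s (.buyer' j) = M.demandOne p j := fun j =>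
      Finset.sum_congr rfl (mem_preferredBundles_iff_tiers.1 (hy j)).2.1
    have h2 : ∀ j, M.tierFlow p y .s (.buyer'' j) = M.demandTwo p j := fun j =>
      (mem_preferredBundles_iff_tiers.1 (hy j)).2.2.1
    have hb : ∀ i j, y i j ≤ M.supply i := fun i j => (hy j).1.2 i
    have h3 : ∀ j, M.tierFlow p y .s (.buyer''' j) ≤ M.demandThree p j := fun j => by
      refine le_min (Finset.sum_le_sum fun i _ => hb i j) ?_
      have := htot j
      have := h1 j
      have := h2 j
      omega
    have h4 : ∀ i j, M.tierFlow p y (.buyer' j) (.object i) ≤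
        if i ∈ M.tierOne p j then M.supply i else 0 := fun i j => by
      simp only [tierFlow]
      split_ifs
      · exact hb i j
      · exact le_rfl
    have h5 : ∀ i j, M.tierFlow p y (.buyer'' j) (.object i) ≤
        if i ∈ M.tierTwo p j then min (M.supply i) (M.demandTwo p j) else 0 := fun i j => by
      simp only [tierFlow]
      split_ifs with hi
      · refine le_min (hb i j) ((h2 j).le.trans' ?_)
        exact Finset.single_le_sum (f := fun i => y i j) (fun _ _ => Nat.zero_le _) hi
      · exact le_rfl
    have h6 : ∀ i j, M.tierFlow p y (.buyer''' j) (.object i) ≤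
        if i ∈ M.tierThree p j then M.supply i else 0 := fun i j => by
      simp only [tierFlow]
      split_ifs
      · exact hb i j
      · exact le_rfl
    have h7 : ∀ i, M.tierFlow p y (.object i) .t ≤ M.supply i := fun i => (hs i).le
    intro u w
    rcases u with _ | _ | j | j | j | i <;> rcases w with _ | _ | j' | j' | j' | i'
    case s.buyer' => exact (h1 j').le
    case s.buyer'' => exact (h2 j').le
    case s.buyer''' => exact h3 j'
    case buyer'.object => exact h4 i' j
    case buyer''.object => exact h5 i' j
    case buyer'''.object => exact h6 i' j
    case object.t => exact h7 i
    all_goals exact Nat.zero_le 0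
  refine ⟨M.tierFlow p y, isFlow_extendedNetwork_iff.2 ⟨hcap, hc1, hc2, hc3, fun i => ?_⟩, ?_⟩
  · exact Finset.sum_congr rfl fun j _ => tierAllocation_tierFlow (hy j) i
  · rw [value_extendedNetwork hcap]
    exact Finset.sum_congr rfl fun j _ => by exact_mod_cast htot j

/-- Conversely, a flow of this value in a balanced market gives preferred bundles to all buyers,
sells all items and meets all demands. -/
theorem tierAllocation_of_isFlow {M : Market Ω N} {p : Ω → ℝ} {f : VertexH Ω N → VertexH Ω N → ℕ}
    (hf : (M.extendedNetwork p).IsFlow f) (hbal : ∑ i, M.supply i = ∑ j, M.demand j)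
    (hval : ∑ j, (M.demand j : ℤ) ≤ (M.extendedNetwork p).value f) :
    (∀ j, (fun i => tierAllocation f i j) ∈ M.preferredBundles p j) ∧
      (∀ i, ∑ j, tierAllocation f i j = M.supply i) ∧
      ∀ j, ∑ i, tierAllocation f i j = M.demand j := by
  classical
  obtain ⟨hcap, hc1, hc2, hc3, hc4⟩ := isFlow_extendedNetwork_iff.1 hf
  rw [value_extendedNetwork hcap] at hval
  have hle1 : ∀ j, f .s (.buyer' j) ≤ M.demandOne p j := fun j => hcap .s (.buyer' j)
  have hle2 : ∀ j, f .s (.buyer'' j) ≤ M.demandTwo p j := fun j => hcap .s (.buyer'' j)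
  have hle3 : ∀ j, f .s (.buyer''' j) ≤ M.demand j - M.demandOne p j - M.demandTwo p j := fun j =>
    (hcap .s (.buyer''' j)).trans (min_le_right _ _)
  have hle : ∀ j, f .s (.buyer' j) + f .s (.buyer'' j) + f .s (.buyer''' j) ≤ M.demand j := fun j => by
    have := hle1 j
    have := hle2 j
    have := hle3 j
    have := M.demandOne_add_demandTwo_le p j
    omega
  have heq : ∀ j, f .s (.buyer' j) + f .s (.buyer'' j) + f .s (.buyer''' j) = M.demand j := fun j =>
    (Finset.sum_eq_sum_iff_of_le fun j _ => hle j).1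
      (le_antisymm (Finset.sum_le_sum fun j _ => hle j) (by exact_mod_cast hval)) j
      (Finset.mem_univ j)
  have hs1 : ∀ j, f .s (.buyer' j) = M.demandOne p j := fun j => by
    have := heq j
    have := hle1 j
    have := hle2 j
    have := hle3 j
    have := M.demandOne_add_demandTwo_le p j
    omega
  have hs2 : ∀ j, f .s (.buyer'' j) = M.demandTwo p j := fun j => by
    have := heq j
    have := hle1 j
    have := hle2 j
    have := hle3 j
    have := M.demandOne_add_demandTwo_le p j
    omega
  have hdem : ∀ j, ∑ i, tierAllocation f i j = M.demand j := fun j => by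
    simp only [tierAllocation, Finset.sum_add_distrib]
    rw [← hc1, ← hc2, ← hc3, heq]
  have hsup : ∀ i, ∑ j, tierAllocation f i j = M.supply i := fun i => by
    have hle4 : ∀ i, ∑ j, tierAllocation f i j ≤ M.supply i := fun i =>
      (hc4 i).le.trans (hcap (.object i) .t)
    refine (Finset.sum_eq_sum_iff_of_le fun i _ => hle4 i).1 ?_ i (Finset.mem_univ i)
    rw [Finset.sum_comm, hbal]
    exact Finset.sum_congr rfl fun j _ => hdem j
  have hb1 : ∀ i j, f (.buyer' j) (.object i) ≤ if i ∈ M.tierOne p j then M.supply i else 0 :=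
    fun i j => hcap (.buyer' j) (.object i)
  have hb2 : ∀ i j, f (.buyer'' j) (.object i) ≤
      if i ∈ M.tierTwo p j then min (M.supply i) (M.demandTwo p j) else 0 :=
    fun i j => hcap (.buyer'' j) (.object i)
  have hb3 : ∀ i j, f (.buyer''' j) (.object i) ≤ if i ∈ M.tierThree p j then M.supply i else 0 :=
    fun i j => hcap (.buyer''' j) (.object i)
  have hz1 : ∀ i j, i ∉ M.tierOne p j → f (.buyer' j) (.object i) = 0 := fun i j hi => by
    simpa [hi] using hb1 i j
  have hz2 : ∀ i j, i ∉ M.tierTwo p j → f (.buyer'' j) (.object i) = 0 := fun i j hi => by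
    simpa [hi] using hb2 i j
  have hz3 : ∀ i j, i ∉ M.tierThree p j → f (.buyer''' j) (.object i) = 0 := fun i j hi => by
    simpa [hi] using hb3 i j
  have hfull : ∀ j, ∀ i ∈ M.tierOne p j, f (.buyer' j) (.object i) = M.supply i := by
    intro j
    refine (Finset.sum_eq_sum_iff_of_le fun i hi => ?_).1 ?_
    · simpa [hi] using hb1 i j
    · refine Eq.trans ?_ ((hc1 j).symm.trans (hs1 j))
      exact Finset.sum_subset (Finset.subset_univ _) fun i _ hi => hz1 i j hi
  refine ⟨fun j => mem_preferredBundles_iff_tiers.2 ⟨⟨(hdem j).le, fun i => ?_⟩, fun i hi => ?_, ?_,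
    fun i h1 h2 h3 => ?_⟩, hsup, hdem⟩
  · exact (Finset.single_le_sum (f := fun j => tierAllocation f i j) (fun _ _ => Nat.zero_le _)
      (Finset.mem_univ j)).trans (hsup i).le
  · have h2 := hz2 i j (Finset.disjoint_left.1 (M.disjoint_tierOne_tierTwo p j) hi)
    have h3 := hz3 i j fun h => (payoff_pos_of_mem_tierOne hi).ne' (mem_tierThree.1 h)
    simp only [tierAllocation, h2, h3, add_zero]
    exact hfull j i hi
  · rw [← hs2, hc2]
    refine Eq.trans (Finset.sum_congr rfl fun i hi => ?_)
      (Finset.sum_subset (Finset.subset_univ _) fun i _ hi => hz2 i j hi)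
    have h1 := hz1 i j (Finset.disjoint_right.1 (M.disjoint_tierOne_tierTwo p j) hi)
    have h3 := hz3 i j fun h => (payoff_pos_of_mem_tierTwo hi).ne' (mem_tierThree.1 h)
    simp only [tierAllocation, h1, h3, add_zero, zero_add]
  · simp only [tierAllocation, hz1 i j h1, hz2 i j h2, hz3 i j h3]

/-! ### The balanced market -/

theorem balanced_sum_supply (M : Market Ω N) :
    ∑ i, M.balanced.supply i = ∑ j, M.balanced.demand j := by
  rw [Fintype.sum_option, Fintype.sum_option]
  simp only [balanced]
  omega

theorem payoff_balanced_none (M : Market Ω N) (p : Ω → ℝ) (j : Option N) :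
    M.balanced.payoff (extendPrice p) j none = 0 := by
  cases j <;> simp [payoff, balanced, extendPrice]

theorem payoff_balanced_some (M : Market Ω N) (p : Ω → ℝ) (j : N) (i : Ω) :
    M.balanced.payoff (extendPrice p) (some j) (some i) = M.payoff p j i := rfl

theorem payoff_balanced_dummy (M : Market Ω N) (p : Ω → ℝ) (i : Ω) :
    M.balanced.payoff (extendPrice p) none (some i) = - p i := by
  simp [payoff, balanced, extendPrice]

/-- Without the dummy object, a preferred bundle of the balanced market is a preferred bundle of the
market. -/
theorem mem_preferredBundles_of_balanced {M : Market Ω N} {p : Ω → ℝ} {j : N} {y : Option Ω → ℕ}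
    (hy : y ∈ M.balanced.preferredBundles (extendPrice p) (some j)) :
    (fun i => y (some i)) ∈ M.preferredBundles p j := by
  have hy1 : ∑ i, y i ≤ M.demand j := hy.1.1
  rw [Fintype.sum_option] at hy1
  refine ⟨⟨(Nat.le_add_left _ _).trans hy1, fun i => hy.1.2 (some i)⟩, fun z hz => ?_⟩
  have hz' : (fun o : Option Ω => o.elim 0 z) ∈ M.balanced.bundles (some j) := by
    refine ⟨?_, fun o => ?_⟩
    · rw [Fintype.sum_option]
      simpa [balanced] using hz.1
    · cases o with
      | none => exact Nat.zero_le _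
      | some i => exact hz.2 i
  have := hy.2 hz'
  simp only [Set.mem_ofPred_eq, Fintype.sum_option, payoff_balanced_none, payoff_balanced_some,
    zero_mul, zero_add, Option.elim_some] at this
  exact this

/-- A stable allocation that sells all objects of positive price, and leaves no item unsold if there
is residual demand, extends to the balanced market. -/
theorem exists_balanced_allocation {M : Market Ω N} {p : Ω → ℝ} {x : Ω → N → ℕ}
    (hx : M.IsStable p x) (hpos : ∀ i, 0 < p i → ∑ j, x i j = M.supply i)
    (hmax : ∀ i j, ∑ j, x i j = M.supply i ∨ ∑ i, x i j = M.demand j) (hp : ∀ i, 0 ≤ p i) :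
    ∃ y : Option Ω → Option N → ℕ,
      (∀ j, (fun i => y i j) ∈ M.balanced.preferredBundles (extendPrice p) j) ∧
      (∀ i, ∑ j, y i j = M.balanced.supply i) ∧ ∀ j, ∑ i, y i j = M.balanced.demand j := by
  classical
  have hxs := hx.1.1
  have hxd := hx.1.2
  let y : Option Ω → Option N → ℕ := fun
    | some i, some j => x i j
    | some i, none => M.supply i - ∑ j, x i j
    | none, some j => M.demand j - ∑ i, x i j
    | none, none => 0
  have hs : ∑ i, (M.supply i - ∑ j, x i j) + ∑ i, ∑ j, x i j = ∑ i, M.supply i := by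
    rw [← Finset.sum_add_distrib]
    exact Finset.sum_congr rfl fun i _ => Nat.sub_add_cancel (hxs i)
  have hd : ∑ j, (M.demand j - ∑ i, x i j) + ∑ i, ∑ j, x i j = ∑ j, M.demand j := by
    rw [Finset.sum_comm, ← Finset.sum_add_distrib]
    exact Finset.sum_congr rfl fun j _ => Nat.sub_add_cancel (hxd j)
  have hor : ∑ i, (M.supply i - ∑ j, x i j) = 0 ∨ ∑ j, (M.demand j - ∑ i, x i j) = 0 := by
    by_cases h : ∀ i, ∑ j, x i j = M.supply i
    · exact Or.inl (Finset.sum_eq_zero fun i _ => by rw [h, Nat.sub_self])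
    · push Not at h
      obtain ⟨i, hi⟩ := h
      exact Or.inr (Finset.sum_eq_zero fun j _ => by rw [(hmax i j).resolve_left hi, Nat.sub_self])
  have hys : ∀ i, ∑ j, y i j = M.balanced.supply i := by
    rintro (_ | i) <;> rw [Fintype.sum_option] <;> simp only [y, balanced]
    · omega
    · exact Nat.sub_add_cancel (hxs i)
  have hyd : ∀ j, ∑ i, y i j = M.balanced.demand j := by
    rintro (_ | j) <;> rw [Fintype.sum_option] <;> simp only [y, balanced]
    · omega
    · exact Nat.sub_add_cancel (hxd j)
  refine ⟨y, fun j => mem_preferredBundles_iff.2 ⟨⟨(hyd j).le, fun i => ?_⟩, ?_⟩, hys, hyd⟩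
  · exact (Finset.single_le_sum (f := fun j => y i j) (fun _ _ => Nat.zero_le _)
      (Finset.mem_univ j)).trans (hys i).le
  cases j with
  | none =>
    refine ⟨0, le_rfl, ?_, ?_, fun _ => rfl⟩
    · rintro (_ | i) hi
      · rw [payoff_balanced_none] at hi
        exact absurd hi (lt_irrefl _)
      · rw [payoff_balanced_dummy] at hi
        linarith [hp i]
    · rintro (_ | i) hi
      · rfl
      · rw [payoff_balanced_dummy] at hi
        simp only [y]
        rw [hpos i (by linarith), Nat.sub_self]
  | some j =>
    obtain ⟨-, c, h0, h1, h2, h3⟩ := mem_preferredBundles_iff.1 (hx.2 j)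
    refine ⟨c, h0, ?_, ?_, fun h => absurd (hyd (some j)) h.ne⟩
    · rintro (_ | i) hi
      · rw [payoff_balanced_none] at hi
        linarith
      · exact h1 i hi
    · rintro (_ | i) hi
      · rw [payoff_balanced_none] at hi
        have : ¬ ∑ i, x i j < M.demand j := fun h => hi.ne' (h3 h)
        simp only [y]
        omega
      · exact h2 i hi

/-- Allocations of the balanced market, without the dummies. -/
theorem spec_of_balanced_allocation {M : Market Ω N} {p : Ω → ℝ} {X : Option Ω → Option N → ℕ}
    (hX : ∀ j, (fun i => X i j) ∈ M.balanced.preferredBundles (extendPrice p) j)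
    (hs : ∀ i, ∑ j, X i j = M.balanced.supply i) (hd : ∀ j, ∑ i, X i j = M.balanced.demand j) :
    M.IsStable p (fun i j => X (some i) (some j)) ∧
      ∑ i, ∑ j, X (some i) (some j) = min (∑ i, M.supply i) (∑ j, M.demand j) ∧
      ∀ i, 0 < p i → ∑ j, X (some i) (some j) = M.supply i := by
  have hs' : ∀ i, X (some i) none + ∑ j, X (some i) (some j) = M.supply i := fun i => by
    rw [← Fintype.sum_option]
    exact hs (some i)
  have hd' : ∀ j, X none (some j) + ∑ i, X (some i) (some j) = M.demand j := fun j => by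
    rw [← Fintype.sum_option (fun i => X i (some j))]
    exact hd (some j)
  have hsn : X none none + ∑ j, X none (some j) = ∑ j, M.demand j - ∑ i, M.supply i := by
    rw [← Fintype.sum_option]
    exact hs none
  have hdn : X none none + ∑ i, X (some i) none = ∑ i, M.supply i - ∑ j, M.demand j := by
    rw [← Fintype.sum_option (fun i => X i none)]
    exact hd none
  refine ⟨⟨⟨fun i => (Nat.le_add_left _ _).trans (hs' i).le,
    fun j => (Nat.le_add_left _ _).trans (hd' j).le⟩,
    fun j => mem_preferredBundles_of_balanced (hX (some j))⟩, ?_, fun i hi => ?_⟩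
  · have h1 : ∑ i, (X (some i) none + ∑ j, X (some i) (some j)) = ∑ i, M.supply i :=
      Finset.sum_congr rfl fun i _ => hs' i
    have h2 : ∑ j, (X none (some j) + ∑ i, X (some i) (some j)) = ∑ j, M.demand j :=
      Finset.sum_congr rfl fun j _ => hd' j
    rw [Finset.sum_add_distrib] at h1 h2
    rw [Finset.sum_comm (s := (Finset.univ : Finset N))] at h2
    omega
  · obtain ⟨-, c, h0, -, h2, -⟩ := mem_preferredBundles_iff.1 (hX none)
    have : X (some i) none = 0 := h2 (some i) (by rw [payoff_balanced_dummy]; linarith)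
    have := hs' i
    omega

/-- The outputs of the allocation algorithm at the least competitive prices. -/
theorem AllocationReturns.spec {M : Market Ω N} {p : Ω → ℝ} {n : Ω → ℕ}
    (hp : IsLeast {q | M.IsCompetitive q} p) (hn : ∀ i, p i = n i) {x : Ω → N → ℕ}
    (hx : M.AllocationReturns p x) :
    M.IsStable p x ∧ ∑ i, ∑ j, x i j = min (∑ i, M.supply i) (∑ j, M.demand j) ∧
      ∀ i, 0 < p i → ∑ j, x i j = M.supply i := by
  obtain ⟨z, hz1, hz2, hz3⟩ := exists_isStable_sold hp hn
  obtain ⟨y, hy1, hy2, hy3⟩ := exists_balanced_allocation hz1 hz2 hz3 hp.1.1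
  obtain ⟨g, hg1, hg2⟩ := exists_isFlow_extendedNetwork hy1 hy2 hy3
  obtain ⟨f, hf, rfl⟩ := hx
  obtain ⟨h1, h2, h3⟩ := tierAllocation_of_isFlow hf.1 M.balanced_sum_supply
    (hg2.ge.trans (hf.2 g hg1))
  exact spec_of_balanced_allocation h1 h2 h3

end Market

theorem mainTheorem1 {Ω N : Type*} [Fintype Ω] [Fintype N] (M : Market Ω N) :
    (¬ ∃ P : ℕ → Ω → ℝ, (∀ i, P 0 i = 0) ∧ ∀ n, M.PriceStep (P n) (P (n + 1))) ∧
    ∃ p : Ω → ℝ,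
      (∀ q, M.PriceRaisingReturns q ↔ q = p) ∧
      IsLeast {q | M.IsCompetitive q} p ∧
      (∃ x, M.AllocationReturns p x) ∧
      (∀ x, M.AllocationReturns p x →
        M.IsStable p x ∧
        ∑ i, ∑ j, x i j = min (∑ i, M.supply i) (∑ j, M.demand j) ∧
        ∀ i, 0 < p i → ∑ j, x i j = M.supply i) ∧
      (∀ q, M.IsBuyerOptimal q ↔ q = p) := by
  refine ⟨M.not_exists_infinite_priceStep, ?_⟩
  obtain ⟨p, hp⟩ := M.exists_priceRaisingReturns
  have hleast := hp.isLeast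
  obtain ⟨n, hn⟩ := (Market.priceStep_invariant hp.1).1
  obtain ⟨f, hf⟩ := (M.networkH p).exists_isMaxFlow
  have hspec := fun x (hx : M.AllocationReturns p x) => hx.spec hleast hn
  have hwal : M.IsWalrasian p := by
    obtain ⟨h1, h2, -⟩ := hspec _ ⟨f, hf, rfl⟩
    exact ⟨hleast.1.1, _, h1, h2⟩
  have hle : ∀ q, M.IsWalrasian q → ∀ i, p i ≤ q i := fun q ⟨hq, x, hx, _⟩ =>
    hleast.2 ⟨hq, x, hx⟩
  refine ⟨p, fun q => ⟨fun hq => hq.isLeast.unique hleast, ?_⟩, hleast, ⟨_, f, hf, rfl⟩, hspec,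
    fun q => ⟨fun hq => ?_, ?_⟩⟩
  · rintro rfl
    exact hp
  · have h1 := hle q hq.1
    have h2 : ∑ i, p i = ∑ i, q i :=
      le_antisymm (Finset.sum_le_sum fun i _ => h1 i) (hq.2 p hwal)
    funext i
    exact ((Finset.sum_eq_sum_iff_of_le fun i _ => h1 i).1 h2 i (Finset.mem_univ i)).symm
  · rintro rfl
    exact ⟨hwal, fun q hq => Finset.sum_le_sum fun i _ => hle q hq i⟩
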